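/- **Setting.** Fix function symbols of positive arity, and a set of constants that consists of program constants and of an infinite reserved supply of auxiliary constants. A literal is $t\approx s$ or $t\not\approx s$ for terms $t,s$ built from these; a conjunction of literals is identified with the set $\Gamma$ of its conjuncts, $\mathcal C(\Gamma)$ and $\mathcal T(\Gamma)$ are the sets of constants and (sub)terms occurring in it, $\models$ is entailment in first-order structures, and $\vdash$ is derivability of literals from the members of $\Gamma$ by reflexivity, symmetry, transitivity, congruence, and replacing equals by equals in disequalities. *Programs.* Over a finite set $\mathsf V$ of program variables, statements are $\mathbf{skip}$, $\mathsf x\gets \mathsf y$, $\mathsf x\gets f(\vec{\mathsf y})$, $\mathbf{assume}(c)$, $s_1;s_2$, $\mathbf{if}\,(c)\,\mathbf{then}\,s_1\,\mathbf{else}\,s_2$, $\mathbf{while}\,(c)\,s$, where $c$ is $\mathsf x=\mathsf y$ or $\mathsf x\ne \mathsf y$. A configuration is $\langle s,q,pc\rangle$ with a statement $s$, a state $q$ mapping variables to program constants, and a set $pc$ of literals; $\mathcal C(q)$ is the range of $q$. The steps are - $\langle\mathbf{skip};s,q,pc\rangle\to\langle s,q,pc\rangle$, and $\langle s_1;s_2,q,pc\rangle\to\langle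 s_1';s_2,q',pc'\rangle$ if $\langle s_1,q,pc\rangle\to\langle s_1',q',pc'\rangle$; - $\langle\mathbf{assume}(c),q,pc\rangle\to\langle\mathbf{skip},q,pc\wedge q(c)\rangle$ if $pc\wedge q(c)$ is satisfiable; - $\langle \mathsf x\gets e,q,pc\rangle\to\langle\mathbf{skip},q[\mathsf x\mapsto x'],pc\wedge x'\approx q(e)\rangle$ for a program constant $x'\in N(q,\mathsf x)$ that is fresh, i.e. $x'\notin\mathcal C(pc)\cup\mathcal C(q)$; here $N(q,\mathsf x)$ is a fixed set of names offered for the new value (possibly all program constants); - $\mathbf{if}\,(c)\,\mathbf{then}\,s_1\,\mathbf{else}\,s_2$ steps to $\mathbf{assume}(c);s_1$ and to $\mathbf{assume}(\neg c);s_2$, and $\mathbf{while}\,(c)\,s$ steps to $\mathbf{if}\,(c)\,\mathbf{then}\,(s;\mathbf{while}\,(c)\,s)\,\mathbf{else}\,\mathbf{skip}$, with $q,pc$ unchanged. $\mathcal S_P$ is the transition system of $P$, with initial configuration $\langle P,q_0,\top\rangle$ for an injective $q_0$. $P$ is *coherent* (a CUP) if for all reachable $\langle s,q,pc\rangle$: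 (memoizing) if the next statement to execute is $\mathsf x\gets f(\vec{\mathsf y})$ and $pc\models t\approx f(q(\vec{\mathsf y}))$ with $t\in\mathcal T(pc)$, then $pc\models q(\mathsf v)\approx t$ for some variable $\mathsf v$; (early assume) if the next statement to execute is $\mathbf{assume}(\mathsf x=\mathsf y)$ and $pc\models t\approx r$ with $t\in\mathcal T(pc)$ and $r$ a superterm of $q(\mathsf x)$ or $q(\mathsf y)$, then $pc\models q(\mathsf v)\approx t$ for some variable $\mathsf v$. *Base abstraction.* For a finite set $V$ of program constants, $\langle W,\beta,\delta\rangle$ is a $V$-basis of $\Gamma$ if (a) $W$ is a finite set of auxiliary constants not in $\mathcal C(\Gamma)$, and $\beta,\delta$ are finite; (b) $(\exists W.\ \beta\wedge\delta)\equiv\Gamma$, and $\beta\wedge\delta$ and $\Gamma$ derive the same literals without constants of $W$; (c) every literal of $\beta$ has one of the forms $u\approx v$, $u\not\approx v$, $v\approx f(\vec w)$ with $u,v\in V$, $\vec w\subseteq V\cup W$, $\vec w\cap V\neq\emptyset$; every literal of $\delta$ has one of the forms $w\approx u$ ($w\in V\cup W$, $u$ a constant not in $V\cup W$), $u\not\approx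 w$ ($u\in W$, $w\in V\cup W$), $v\approx f(\vec w)$ ($v,\vec w\subseteq V\cup W$, and $\vec w\subseteq W$ if $v\in V$); (d) $\beta\wedge\delta\nvdash v\approx w$ for $v\in V$, $w\in W$; (e) $\beta\wedge\delta\nvdash w_1\approx w_2$ for distinct $w_1,w_2\in W$; (f) each $w\in W$ names a class of $\Gamma$: $\beta\wedge\delta\vdash w\approx t$ for some $t\in\mathcal T(\Gamma)$; (g) every literal of a form allowed in $\beta$ that is derivable from $\beta\wedge\delta$ is derivable from $\beta$. Let $\mathrm{base}_\beta(\Gamma,V)$ be the set of all $\beta$ occurring in a $V$-basis of $\Gamma$, closed under permutations of the auxiliary constants in $\beta$. A *base abstraction* is a family of functions $\alpha_V$ on sets of literals such that for all finite satisfiable $\Gamma,\Gamma'$: (1) $\alpha_V(\Gamma)\in\mathrm{base}_\beta(\Gamma,V)$; (2) if $\mathrm{base}_\beta(\Gamma,V)\cap\mathrm{base}_\beta(\Gamma',V)\ne\emptyset$ then $\alpha_V(\Gamma)=\alpha_V(\Gamma')$. Write $\alpha_q=\alpha_{\mathcal C(q)}$ and $\alpha_b(\langle s,q,pc\rangle)=\langle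 s,q,\alpha_q(pc)\rangle$. **Theorem.** Base abstractions exist. Let $\alpha$ be any of them, and let $P$ be a CUP. (1) Let $\langle s,q,pc\rangle$ be reachable in $\mathcal S_P$, and let $s',q',pc'$ be such that the constants in $\mathcal C(q')\setminus\mathcal C(q)$ do not occur in $pc$. Then $\langle s,q,pc\rangle\to\langle s',q',pc\wedge pc'\rangle$ if and only if $\langle s,q,\alpha_q(pc)\rangle\to\langle s',q',\alpha_q(pc)\wedge pc'\rangle$. (2) If $\langle s,q,pc\rangle$ is reachable in $\mathcal S_P$ and $\langle s,q,pc\rangle\to\langle s',q',pc\wedge pc'\rangle$, then $\alpha_{q'}(pc\wedge pc')=\alpha_{q'}(\alpha_q(pc)\wedge pc')$. (3) Suppose that in every reachable configuration whose next statement is an assignment to $\mathsf x$, all names in $N(q,\mathsf x)$ are fresh (e.g. the name offered is always the next numbered version of $\mathsf x$). Let $\alpha_b(\mathcal S_P)$ have the initial configuration $\alpha_b(c_0)$, where $c_0$ is that of $\mathcal S_P$, and the transitions $\alpha_b(c)\to\alpha_b(c')$ for $c\to c'$ in $\mathcal S_P$ with $c$ reachable. Then $\{(c,\alpha_b(c))\mid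 c\text{ reachable in }\mathcal S_P\}$ is a bisimulation from $\mathcal S_P$ to $\alpha_b(\mathcal S_P)$: related configurations can match each other's transitions by transitions to related configurations. -/

import Mathlib

universe u v w x

namespace UP

/-! ## Quantifier-free EUF -/

/-- Constants of the signature.  `Sum.inl k` are the constants that programs may use;
`Sum.inr n` is a reserved infinite supply from which base abstractions take auxiliary constants. -/
abbrev Const (K : Type w) : Type w := K ⊕ ℕ

/-- Terms over the function symbols of `L` and the constants; a constant is a leaf `Term.var c`. -/
abbrev Tm (L : FirstOrder.Language.{u, v}) (K : Type w) : Type (max u w) := L.Term (Const K)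

variable {L : FirstOrder.Language.{u, v}} {K : Type w} {Var : Type x}

/-- The term consisting of a constant. -/
abbrev cst (c : Const K) : Tm L K := FirstOrder.Language.Term.var c

/-- The application of a function symbol to constants. -/
abbrev appc {n : ℕ} (f : L.Functions n) (a : Fin n → Const K) : Tm L K :=
  FirstOrder.Language.Term.func f (fun i => cst (a i))

/-- Literals `t ≈ s` and `t ≉ s`. -/
inductive Lit (L : FirstOrder.Language.{u, v}) (K : Type w) : Type (max u w)
  | eq (t s : Tm L K) : Lit L K
  | ne (t s : Tm L K) : Lit L K

/-- A conjunction of literals, identified with the set of its conjuncts; `⊤` is `∅`. -/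
abbrev Lits (L : FirstOrder.Language.{u, v}) (K : Type w) : Type (max u w) := Set (Lit L K)

/-- `Subterm t s`: `t` is a subterm of `s`, i.e. `s` is a superterm of `t`. -/
inductive Subterm : Tm L K → Tm L K → Prop
  | refl (t : Tm L K) : Subterm t t
  | arg {t : Tm L K} {n : ℕ} (f : L.Functions n) (ts : Fin n → Tm L K) (i : Fin n) :
      Subterm t (ts i) → Subterm t (FirstOrder.Language.Term.func f ts)

/-- The terms occurring in a literal. -/
def Lit.terms : Lit L K → Set (Tm L K)
  | .eq t s => {r | Subterm r t ∨ Subterm r s}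
  | .ne t s => {r | Subterm r t ∨ Subterm r s}

/-- The terms `𝒯(Γ)` occurring in `Γ`, subterms included. -/
def terms (Γ : Lits L K) : Set (Tm L K) := {t | ∃ l ∈ Γ, t ∈ l.terms}

/-- The constants occurring in a literal. -/
def Lit.consts (l : Lit L K) : Set (Const K) := {c | cst c ∈ l.terms}

/-- The constants `𝒞(Γ)` occurring in `Γ`. -/
def consts (Γ : Lits L K) : Set (Const K) := {c | cst c ∈ terms Γ}

/-- Truth of a literal in a structure, the constants being interpreted by `ν`. -/
def Lit.Holds {M : Type (max u w)} [L.Structure M] (ν : Const K → M) : Lit L K → Prop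
  | .eq t s => t.realize ν = s.realize ν
  | .ne t s => t.realize ν ≠ s.realize ν

/-- Satisfiability, `Γ ⊭ ⊥`. -/
def Satisfiable (Γ : Lits L K) : Prop :=
  ∃ (M : Type (max u w)) (_ : L.Structure M) (ν : Const K → M), ∀ l ∈ Γ, l.Holds ν

/-- Entailment `Γ ⊨ ℓ`. -/
def Entails (Γ : Lits L K) (l : Lit L K) : Prop :=
  ∀ (M : Type (max u w)) [L.Structure M] (ν : Const K → M), (∀ l' ∈ Γ, l'.Holds ν) → l.Holds ν

/-- Derivability `Γ ⊢ ℓ` of literals in the EUF proof system: hypotheses, reflexivity, symmetry,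
transitivity, congruence, and replacement of equals by equals in disequalities.  (The remaining rule
of the proof system concludes `⊥`, which is not a literal.) -/
inductive Derives (Γ : Lits L K) : Lit L K → Prop
  | hyp {l : Lit L K} : l ∈ Γ → Derives Γ l
  | refl (t : Tm L K) : Derives Γ (.eq t t)
  | symm {t s : Tm L K} : Derives Γ (.eq t s) → Derives Γ (.eq s t)
  | trans {t s r : Tm L K} : Derives Γ (.eq t s) → Derives Γ (.eq s r) → Derives Γ (.eq t r)
  | cong {n : ℕ} (f : L.Functions n) (ts ss : Fin n → Tm L K) :
      (∀ i, Derives Γ (.eq (ts i) (ss i))) →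
      Derives Γ (.eq (FirstOrder.Language.Term.func f ts) (FirstOrder.Language.Term.func f ss))
  | ne_symm {t s : Tm L K} : Derives Γ (.ne t s) → Derives Γ (.ne s t)
  | pmod {t s t' s' : Tm L K} : Derives Γ (.ne t s) → Derives Γ (.eq t t') → Derives Γ (.eq s s') →
      Derives Γ (.ne t' s')

/-- Renaming of the auxiliary constants in a literal. -/
def Lit.rename (π : Equiv.Perm ℕ) : Lit L K → Lit L K
  | .eq t s => .eq (t.relabel (Sum.map id π)) (s.relabel (Sum.map id π))
  | .ne t s => .ne (t.relabel (Sum.map id π)) (s.relabel (Sum.map id π))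

/-! ## Uninterpreted programs -/

/-- Conditions `x = y` and `x ≠ y`. -/
inductive Cond (Var : Type x) : Type x
  | eq (a b : Var) : Cond Var
  | ne (a b : Var) : Cond Var

/-- Negation of a condition. -/
def Cond.neg : Cond Var → Cond Var
  | .eq a b => .ne a b
  | .ne a b => .eq a b

/-- Statements of the uninterpreted programming language. -/
inductive Stmt (L : FirstOrder.Language.{u, v}) (Var : Type x) : Type (max u x)
  | skip : Stmt L Var
  | assign (a b : Var) : Stmt L Var
  | assignFn (a : Var) {n : ℕ} (f : L.Functions n) (bs : Fin n → Var) : Stmt L Var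
  | assume (c : Cond Var) : Stmt L Var
  | seq (s₁ s₂ : Stmt L Var) : Stmt L Var
  | ite (c : Cond Var) (s₁ s₂ : Stmt L Var) : Stmt L Var
  | while (c : Cond Var) (s : Stmt L Var) : Stmt L Var

/-- The statement that is executed next. -/
def Stmt.active : Stmt L Var → Stmt L Var
  | .seq s₁ _ => s₁.active
  | s => s

/-- States assign (program) constants to the program variables. -/
abbrev State (Var : Type x) (K : Type w) : Type (max x w) := Var → K

/-- The term denoting the current value of a variable. -/
abbrev State.val (q : State Var K) (a : Var) : Tm L K := cst (Sum.inl (q a))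

/-- The value of a condition in a state. -/
def Cond.lit (q : State Var K) : Cond Var → Lit L K
  | .eq a b => .eq (q.val a) (q.val b)
  | .ne a b => .ne (q.val a) (q.val b)

open Classical in
/-- The updated state `q[a ↦ k]`. -/
noncomputable def State.set (q : State Var K) (a : Var) (k : K) : State Var K :=
  Function.update q a k

/-- A naming discipline: `N q a k` says that in state `q` the constant `k` may be used to name the
value that an assignment to `a` creates, provided `k` is fresh. -/
abbrev Naming (Var : Type x) (K : Type w) : Type (max x w) := State Var K → Var → K → Prop

/-- `k` is fresh for the path condition `pc` and the state `q`. -/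
def Fresh (q : State Var K) (pc : Lits L K) (k : K) : Prop :=
  Sum.inl k ∉ consts pc ∧ k ∉ Set.range q

/-- Small step symbolic semantics: `Step N s q pc s' q' pc'` is the step
`⟨s, q, pc⟩ → ⟨s', q', pc ∧ pc'⟩`. -/
inductive Step (N : Naming Var K) :
    Stmt L Var → State Var K → Lits L K → Stmt L Var → State Var K → Lits L K → Prop
  | skip_seq (s q pc) : Step N (.seq .skip s) q pc s q ∅
  | seq {s₁ q pc s₁' q' pc'} (s₂ : Stmt L Var) :
      Step N s₁ q pc s₁' q' pc' → Step N (.seq s₁ s₂) q pc (.seq s₁' s₂) q' pc'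
  | assume (c : Cond Var) (q pc) :
      Satisfiable (pc ∪ {c.lit q}) → Step N (.assume c) q pc .skip q {c.lit q}
  | assign (a b : Var) (q pc) (k : K) :
      N q a k → Fresh q pc k →
      Step N (.assign a b) q pc .skip (q.set a k) {.eq (cst (Sum.inl k)) (q.val b)}
  | assignFn (a : Var) {n : ℕ} (f : L.Functions n) (bs : Fin n → Var) (q pc) (k : K) :
      N q a k → Fresh q pc k →
      Step N (.assignFn a f bs) q pc .skip (q.set a k)
        {.eq (cst (Sum.inl k)) (appc f (fun i => Sum.inl (q (bs i))))}
  | ite_true (c s₁ s₂ q pc) : Step N (.ite c s₁ s₂) q pc (.seq (.assume c) s₁) q ∅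
  | ite_false (c s₁ s₂ q pc) : Step N (.ite c s₁ s₂) q pc (.seq (.assume c.neg) s₂) q ∅
  | while (c s q pc) : Step N (.while c s) q pc (.ite c (.seq s (.while c s)) .skip) q ∅

/-- Configurations `⟨s, q, pc⟩`. -/
structure Config (L : FirstOrder.Language.{u, v}) (Var : Type x) (K : Type w) where
  stmt : Stmt L Var
  state : State Var K
  pc : Lits L K

/-! ## Transition systems, abstraction, bisimulation -/

universe y z

/-- Transition systems with set of configurations `C`. -/
structure TS (C : Type y) where
  init : C
  tr : C → C → Prop

/-- Reachability from the initial configuration. -/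
def TS.Reach {C : Type y} (S : TS C) (c : C) : Prop := Relation.ReflTransGen S.tr S.init c

/-- The part of a transition system that consists of the transitions of its reachable
configurations. -/
def TS.reachablePart {C : Type y} (S : TS C) : TS C where
  init := S.init
  tr c c' := S.Reach c ∧ S.tr c c'

/-- The abstract transition system induced by an abstraction function. -/
def TS.abs {C : Type y} {D : Type z} (S : TS C) (g : C → D) : TS D where
  init := g S.init
  tr d d' := ∃ c c', S.tr c c' ∧ d = g c ∧ d' = g c'

/-- `ρ` is a simulation from `S` to `T`. -/
def IsSimulation {C : Type y} {D : Type z} (S : TS C) (T : TS D) (ρ : C → D → Prop) : Prop :=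
  ∀ c d, ρ c d → ∀ c', S.tr c c' → ∃ d', T.tr d d' ∧ ρ c' d'

/-- `ρ` is a bisimulation from `S` to `T`. -/
def IsBisimulation {C : Type y} {D : Type z} (S : TS C) (T : TS D) (ρ : C → D → Prop) : Prop :=
  IsSimulation S T ρ ∧ IsSimulation T S (fun d c => ρ c d)

/-- The transition system `𝒮_P` of a program, started in `⟨P, q₀, ⊤⟩`. -/
def programTS (q₀ : State Var K) (N : Naming Var K) (P : Stmt L Var) : TS (Config L Var K) where
  init := ⟨P, q₀, ∅⟩
  tr c c' := ∃ pc', Step N c.stmt c.state c.pc c'.stmt c'.state pc' ∧ c'.pc = c.pc ∪ pc'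

/-- Coherence: every reachable configuration is memoizing and satisfies early assumes. -/
structure Coherent (q₀ : State Var K) (N : Naming Var K) (P : Stmt L Var) : Prop where
  memoizing : ∀ s q pc, (programTS q₀ N P).Reach ⟨s, q, pc⟩ →
    ∀ (a : Var) (n : ℕ) (f : L.Functions n) (bs : Fin n → Var), s.active = .assignFn a f bs →
    ∀ t ∈ terms pc, Entails pc (.eq t (appc f (fun i => Sum.inl (q (bs i))))) →
    ∃ z : Var, Entails pc (.eq (q.val z) t)
  earlyAssume : ∀ s q pc, (programTS q₀ N P).Reach ⟨s, q, pc⟩ →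
    ∀ a b : Var, s.active = .assume (.eq a b) →
    ∀ t ∈ terms pc, ∀ r : Tm L K, (Subterm (q.val a) r ∨ Subterm (q.val b) r) →
    Entails pc (.eq t r) → ∃ z : Var, Entails pc (.eq (q.val z) t)

/-- The naming discipline never offers a used constant: in every reachable configuration that is
about to execute an assignment, all the constants it offers are fresh. -/
def AlwaysFresh (q₀ : State Var K) (N : Naming Var K) (P : Stmt L Var) : Prop :=
  ∀ s q pc, (programTS q₀ N P).Reach ⟨s, q, pc⟩ →
    ∀ a : Var, ((∃ b, s.active = .assign a b) ∨
      ∃ (n : ℕ) (f : L.Functions n) (bs : Fin n → Var), s.active = .assignFn a f bs) →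
    ∀ k, N q a k → Fresh q pc k

/-! ## Bases and the base abstraction -/

/-- The constants in `V`. -/
def inV (V : Set K) : Set (Const K) := Sum.inl '' V

/-- The auxiliary constants in `W`. -/
def inW (W : Set ℕ) : Set (Const K) := Sum.inr '' W

/-- The constants in `V ∪ W`. -/
def inVW (V : Set K) (W : Set ℕ) : Set (Const K) := inV V ∪ inW W

/-- The literals allowed in `β`: `u ≈ v` and `u ≉ v` with `u, v ∈ V`, and `v ≈ f(w⃗)` with `v ∈ V`,
`w⃗ ⊆ V ∪ W` and `w⃗ ∩ V ≠ ∅`. -/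
inductive BetaShape (V : Set K) (W : Set ℕ) : Lit L K → Prop
  | eq {a b : Const K} : a ∈ inV V → b ∈ inV V → BetaShape V W (.eq (cst a) (cst b))
  | ne {a b : Const K} : a ∈ inV V → b ∈ inV V → BetaShape V W (.ne (cst a) (cst b))
  | fn {a : Const K} {n : ℕ} (f : L.Functions n) (bs : Fin n → Const K) :
      a ∈ inV V → (∀ i, bs i ∈ inVW V W) → (∃ i, bs i ∈ inV V) →
      BetaShape V W (.eq (cst a) (appc f bs))

/-- The literals allowed in `δ`: `w ≈ u` with `w ∈ V ∪ W` and a constant `u ∉ V ∪ W`; `u ≉ w` with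
`u ∈ W` and `w ∈ V ∪ W`; and `v ≈ f(w⃗)` with `v, w⃗ ⊆ V ∪ W`, where `w⃗ ⊆ W` if `v ∈ V`. -/
inductive DeltaShape (V : Set K) (W : Set ℕ) : Lit L K → Prop
  | eq {a b : Const K} : a ∈ inVW V W → b ∉ inVW V W → DeltaShape V W (.eq (cst a) (cst b))
  | ne {a b : Const K} : a ∈ inW W → b ∈ inVW V W → DeltaShape V W (.ne (cst a) (cst b))
  | fn {a : Const K} {n : ℕ} (f : L.Functions n) (bs : Fin n → Const K) :
      a ∈ inVW V W → (∀ i, bs i ∈ inVW V W) → (a ∈ inV V → ∀ i, bs i ∈ inW W) →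
      DeltaShape V W (.eq (cst a) (appc f bs))

/-- `⟨W, β, δ⟩` is a `V`-basis of `Γ`: a description of the congruence graph of `Γ` in which the
classes are named by constants of `V` where possible, and by the fresh constants of `W` otherwise. -/
structure IsBasis (Γ : Lits L K) (V : Set K) (W : Set ℕ) (β δ : Lits L K) : Prop where
  finite_W : W.Finite
  finite_β : β.Finite
  finite_δ : δ.Finite
  /-- the constants of `W` are fresh -/
  fresh : ∀ n ∈ W, Sum.inr n ∉ consts Γ
  /-- `∃ W. β ∧ δ` is logically equivalent to `Γ` -/
  equiv : ∀ (M : Type (max u w)) [L.Structure M] (ν : Const K → M),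
    (∃ ν' : Const K → M, (∀ c, c ∉ inW W → ν' c = ν c) ∧ ∀ l ∈ β ∪ δ, l.Holds ν') ↔
      ∀ l ∈ Γ, l.Holds ν
  /-- `β ∧ δ` and `Γ` have the same derivable literals without constants of `W` -/
  derives_iff : ∀ l : Lit L K, Disjoint l.consts (inW W) → (Derives (β ∪ δ) l ↔ Derives Γ l)
  shape_β : ∀ l ∈ β, BetaShape V W l
  shape_δ : ∀ l ∈ δ, DeltaShape V W l
  /-- the constants of `W` name classes without a representative in `V` … -/
  not_V : ∀ v ∈ V, ∀ n ∈ W, ¬ Derives (β ∪ δ) (.eq (cst (Sum.inl v)) (cst (Sum.inr n)))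
  /-- … different ones name different classes … -/
  injective : ∀ n ∈ W, ∀ m ∈ W, n ≠ m →
    ¬ Derives (β ∪ δ) (.eq (cst (Sum.inr n)) (cst (Sum.inr m)))
  /-- … and each of them names the class of some term of `Γ` -/
  names : ∀ n ∈ W, ∃ t ∈ terms Γ, Derives (β ∪ δ) (.eq (cst (Sum.inr n)) t)
  /-- no consequence that `β` can express is left to `δ` -/
  complete : ∀ l, BetaShape V W l → Derives (β ∪ δ) l → Derives β l

/-- `β` is the first component of a `V`-basis of `Γ`, up to the names of the constants of `W`
(which are bound in `∃ W. β ∧ δ`). -/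
def IsBase (Γ : Lits L K) (V : Set K) (β : Lits L K) : Prop :=
  ∃ (π : Equiv.Perm ℕ) (W : Set ℕ) (β' δ : Lits L K), IsBasis Γ V W β' δ ∧ β = Lit.rename π '' β'

/-- `α` is a base abstraction: for each finite set `V` of program constants, `α V` maps every
(finite, satisfiable) set of literals to the `β` of one of its `V`-bases, and two such sets that
share a `β` have the same image. -/
structure IsBaseAbstraction (α : Set K → Lits L K → Lits L K) : Prop where
  isBase : ∀ V : Set K, V.Finite → ∀ Γ : Lits L K, Γ.Finite → Satisfiable Γ → IsBase Γ V (α V Γ)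
  canonical : ∀ V : Set K, V.Finite → ∀ Γ Γ' : Lits L K, Γ.Finite → Satisfiable Γ → Γ'.Finite →
    Satisfiable Γ' → (∃ β, IsBase Γ V β ∧ IsBase Γ' V β) → α V Γ = α V Γ'

/-- The base abstraction of configurations: `α_b ⟨s, q, pc⟩ = ⟨s, q, α_{𝒞(q)}(pc)⟩`. -/
def absConfig (α : Set K → Lits L K → Lits L K) (c : Config L Var K) : Config L Var K :=
  ⟨c.stmt, c.state, α (Set.range c.state) c.pc⟩

end UP

namespace UP

open FirstOrder.Language (Term)

variable {L : FirstOrder.Language.{u, v}} {K : Type w}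

/-! ## Terms, literals, substitutions -/

/-! A program in state `q` can observe `Γ` only through the constants in `V`, the range of `q`:
equations and disequations between them, and equations `v ≈ f(…)` where `v` and at least one
argument are named by `V`. Two sets of literals agree on this if some relation between their terms
fixes the constants of `V`, preserves and reflects derivable equality of related terms, and carries
every such occurring application to one on the other side. This is `InterfaceEquiv` (a "matching");
arguments not named by `V` matter only up to the relation, just as auxiliary constants matter only
up to renaming.

The pivot is `isBase_iff`: for finite `Γ` and `V`, the bases of `Γ` are exactly the finite sets of
`β`-shaped literals that match `Γ`. A basis matches because its auxiliary constants can be replaced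
by the terms they name, and because `δ` adds nothing visible from `V`. Conversely, a matching
identifies the auxiliary constants of `β` with classes of `Γ`, and everything else that `Γ` says can
be put into `δ` (`IsNaming.isBasis`). So matching sets have the same bases: choosing from the set of
bases gives a base abstraction, and every base abstraction identifies matching sets.

It remains that a path condition and its base still match after each step. A copy `k ≈ b` is
eliminated by substitution. For `k ≈ f(…)`, memoizing leaves two cases: the value is named by `V`,
which is a copy, or it equals no occurring term, and then `k` names a new isolated class on both
sides (`InterfaceEquiv.union_fn`). A disequation creates no equalities. An equation `a ≈ b` could
trigger congruences through `δ` that `β` does not see; but these go through superterms of `a` or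
`b`, whose classes are named by `V` by early assume, so the congruence already happens in `β`.
`IsBasis.exists_model_union_eq` turns this into a model, from which both the transfer of
satisfiability and a basis of the extended set follow. -/

@[simp] theorem subterm_var {t : Tm L K} {c : Const K} : Subterm t (cst c) ↔ t = cst c := by
  constructor
  · intro h; cases h; rfl
  · rintro rfl; exact .refl _

theorem subterm_func {t : Tm L K} {n : ℕ} {f : L.Functions n} {ts : Fin n → Tm L K} :
    Subterm t (Term.func f ts) ↔ t = Term.func f ts ∨ ∃ i, Subterm t (ts i) := by
  constructor
  · intro h
    cases h with
    | refl => exact .inl rfl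
    | arg f ts i h => exact .inr ⟨i, h⟩
  · rintro (rfl | ⟨i, h⟩)
    · exact .refl _
    · exact .arg f ts i h

theorem subterm_cst_func {c : Const K} {n : ℕ} {f : L.Functions n} {ts : Fin n → Tm L K} :
    Subterm (cst c) (Term.func f ts) ↔ ∃ i, Subterm (cst c) (ts i) := by
  simp [subterm_func]

theorem Subterm.trans {t s r : Tm L K} (h : Subterm t s) (h' : Subterm s r) : Subterm t r := by
  induction h' with
  | refl => exact h
  | arg f ts i _ ih => exact .arg f ts i ih

theorem Subterm.mem_terms {Γ : Lits L K} {t s : Tm L K} (h : Subterm t s) (hs : s ∈ terms Γ) :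
    t ∈ terms Γ := by
  obtain ⟨l, hl, h'⟩ := hs
  refine ⟨l, hl, ?_⟩
  cases l with
  | eq a b => exact h'.imp h.trans h.trans
  | ne a b => exact h'.imp h.trans h.trans

theorem arg_mem_terms {Γ : Lits L K} {n : ℕ} {f : L.Functions n} {ts : Fin n → Tm L K}
    (h : Term.func f ts ∈ terms Γ) (i : Fin n) : ts i ∈ terms Γ :=
  Subterm.mem_terms (.arg f ts i (.refl _)) h

theorem terms_mono {Γ Γ' : Lits L K} (h : Γ ⊆ Γ') : terms Γ ⊆ terms Γ' :=
  fun _ ⟨l, hl, ht⟩ => ⟨l, h hl, ht⟩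

theorem terms_union {Γ Γ' : Lits L K} : terms (Γ ∪ Γ') = terms Γ ∪ terms Γ' := by
  ext t
  constructor
  · rintro ⟨l, hl | hl, ht⟩
    · exact .inl ⟨l, hl, ht⟩
    · exact .inr ⟨l, hl, ht⟩
  · rintro (⟨l, hl, ht⟩ | ⟨l, hl, ht⟩)
    · exact ⟨l, .inl hl, ht⟩
    · exact ⟨l, .inr hl, ht⟩

theorem left_mem_terms {Γ : Lits L K} {t s : Tm L K} (h : Lit.eq t s ∈ Γ) : t ∈ terms Γ :=
  ⟨_, h, .inl (.refl _)⟩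

theorem right_mem_terms {Γ : Lits L K} {t s : Tm L K} (h : Lit.eq t s ∈ Γ) : s ∈ terms Γ :=
  ⟨_, h, .inr (.refl _)⟩

theorem finite_subterms (t : Tm L K) : {s | Subterm s t}.Finite := by
  induction t with
  | var c => simp
  | func f ts ih =>
    have : {s | Subterm s (Term.func f ts)} = {Term.func f ts} ∪ ⋃ i, {s | Subterm s (ts i)} := by
      ext s; simp [subterm_func]
    rw [this]
    exact (Set.finite_singleton _).union (Set.finite_iUnion ih)

theorem finite_lit_terms (l : Lit L K) : l.terms.Finite := by
  cases l with
  | eq t s => exact (finite_subterms t).union (finite_subterms s)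
  | ne t s => exact (finite_subterms t).union (finite_subterms s)

theorem finite_terms {Γ : Lits L K} (h : Γ.Finite) : (terms Γ).Finite := by
  have : terms Γ = ⋃ l ∈ Γ, l.terms := by ext; simp [terms]
  rw [this]
  exact h.biUnion fun l _ => finite_lit_terms l

theorem finite_consts {Γ : Lits L K} (h : Γ.Finite) : (consts Γ).Finite :=
  (finite_terms h).preimage (fun _ _ _ _ h => by simpa using h)

/-- Substitution of terms for constants in a literal. -/
def Lit.subst (σ : Const K → Tm L K) : Lit L K → Lit L K
  | .eq t s => .eq (t.subst σ) (s.subst σ)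
  | .ne t s => .ne (t.subst σ) (s.subst σ)

theorem subst_eq_self {σ : Const K → Tm L K} {t : Tm L K}
    (h : ∀ c, Subterm (cst c) t → σ c = cst c) : t.subst σ = t := by
  induction t with
  | var c => exact h c (.refl _)
  | func f ts ih =>
    simp only [Term.subst]
    congr 1
    ext1 i
    exact ih i fun c hc => h c (.arg f ts i hc)

theorem Lit.subst_eq_self {σ : Const K → Tm L K} {l : Lit L K}
    (h : ∀ c ∈ l.consts, σ c = cst c) : l.subst σ = l := by
  cases l with
  | eq t s =>
    simp only [Lit.subst, UP.subst_eq_self fun c hc => h c (.inl hc),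
      UP.subst_eq_self fun c hc => h c (.inr hc)]
  | ne t s =>
    simp only [Lit.subst, UP.subst_eq_self fun c hc => h c (.inl hc),
      UP.subst_eq_self fun c hc => h c (.inr hc)]

theorem subst_eq_self_of_mem {σ : Const K → Tm L K} {Γ : Lits L K}
    (h : ∀ c ∈ consts Γ, σ c = cst c) {t : Tm L K} (ht : t ∈ terms Γ) : t.subst σ = t :=
  subst_eq_self fun _ hc => h _ (hc.mem_terms ht)

theorem subterm_cst_subst {σ : Const K → Tm L K} {t : Tm L K} {c : Const K}
    (h : Subterm (cst c) (t.subst σ)) : ∃ d, Subterm (cst d) t ∧ Subterm (cst c) (σ d) := by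
  induction t with
  | var d => exact ⟨d, .refl _, h⟩
  | func f ts ih =>
    simp only [Term.subst, subterm_cst_func] at h
    obtain ⟨i, hi⟩ := h
    obtain ⟨d, hd, hc⟩ := ih i hi
    exact ⟨d, .arg f ts i hd, hc⟩

theorem Lit.mem_consts_subst {σ : Const K → Tm L K} {l : Lit L K} {c : Const K}
    (h : c ∈ (l.subst σ).consts) : ∃ d ∈ l.consts, Subterm (cst c) (σ d) := by
  cases l with
  | eq t s =>
    rcases h with h | h <;> obtain ⟨d, hd, hc⟩ := subterm_cst_subst h
    · exact ⟨d, .inl hd, hc⟩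
    · exact ⟨d, .inr hd, hc⟩
  | ne t s =>
    rcases h with h | h <;> obtain ⟨d, hd, hc⟩ := subterm_cst_subst h
    · exact ⟨d, .inl hd, hc⟩
    · exact ⟨d, .inr hd, hc⟩

theorem Subterm.subst {t s : Tm L K} (h : Subterm t s) (σ : Const K → Tm L K) :
    Subterm (t.subst σ) (s.subst σ) := by
  induction h with
  | refl => exact .refl _
  | arg f ts i _ ih => exact .arg f _ i ih

/-- The substitution that renames auxiliary constants. -/
def auxRename (π : ℕ → ℕ) (c : Const K) : Tm L K := cst (Sum.map id π c)

theorem relabel_eq_subst (g : Const K → Const K) (t : Tm L K) :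
    t.relabel g = t.subst (fun c => cst (g c)) := by
  induction t with
  | var c => rfl
  | func f ts ih => simp [Term.relabel, Term.subst, ih]

theorem Lit.rename_eq_subst (π : Equiv.Perm ℕ) (l : Lit L K) :
    l.rename π = l.subst (auxRename π) := by
  cases l <;> simp only [Lit.rename, Lit.subst, relabel_eq_subst] <;> rfl

theorem subst_auxRename_symm (π : Equiv.Perm ℕ) (t : Tm L K) :
    (t.subst (auxRename π)).subst (auxRename π.symm) = t := by
  induction t with
  | var c => rcases c with c | c <;> simp [auxRename, Term.subst]
  | func f ts ih => simp [Term.subst, ih]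

theorem Lit.subst_auxRename_symm (π : Equiv.Perm ℕ) (l : Lit L K) :
    (l.subst (auxRename π)).subst (auxRename π.symm) = l := by
  cases l <;> simp [Lit.subst, UP.subst_auxRename_symm]

theorem mem_terms_image_subst {σ : Const K → Tm L K} {Γ : Lits L K} {t : Tm L K}
    (h : t ∈ terms Γ) : t.subst σ ∈ terms (Lit.subst σ '' Γ) := by
  obtain ⟨l, hl, ht⟩ := h
  refine ⟨_, ⟨l, hl, rfl⟩, ?_⟩
  cases l with
  | eq a b => exact ht.imp (fun h => h.subst σ) (fun h => h.subst σ)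
  | ne a b => exact ht.imp (fun h => h.subst σ) (fun h => h.subst σ)

/-! ## Derivability -/

/-- `DEq Γ t s`: the equation `t ≈ s` is derivable from `Γ`. -/
abbrev DEq (Γ : Lits L K) (t s : Tm L K) : Prop := Derives Γ (.eq t s)

theorem Derives.subst {Γ Γ' : Lits L K} {σ : Const K → Tm L K}
    (hσ : ∀ l ∈ Γ, Derives Γ' (l.subst σ)) {l : Lit L K} (h : Derives Γ l) :
    Derives Γ' (l.subst σ) := by
  induction h with
  | hyp h => exact hσ _ h
  | refl t => exact .refl _
  | symm _ ih => exact ih.symm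
  | trans _ _ ih ih' => exact ih.trans ih'
  | cong f ts ss _ ih => exact .cong f _ _ ih
  | ne_symm _ ih => exact ih.ne_symm
  | pmod _ _ _ ih ih' ih'' => exact ih.pmod ih' ih''

theorem Derives.cut {Γ Γ' : Lits L K} (hΓ : ∀ l ∈ Γ, Derives Γ' l) {l : Lit L K}
    (h : Derives Γ l) : Derives Γ' l := by
  induction h with
  | hyp h => exact hΓ _ h
  | refl t => exact .refl _
  | symm _ ih => exact ih.symm
  | trans _ _ ih ih' => exact ih.trans ih'
  | cong f ts ss _ ih => exact .cong f _ _ ih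
  | ne_symm _ ih => exact ih.ne_symm
  | pmod _ _ _ ih ih' ih'' => exact ih.pmod ih' ih''

theorem Derives.mono {Γ Γ' : Lits L K} (hΓ : Γ ⊆ Γ') {l : Lit L K}
    (h : Derives Γ l) : Derives Γ' l := h.cut fun _ hl => .hyp (hΓ hl)

/-- An induction principle for derivations of equations. -/
theorem DEq.rec_eq {Γ : Lits L K} {p : Tm L K → Tm L K → Prop}
    (hyp : ∀ t s, Lit.eq t s ∈ Γ → p t s) (refl : ∀ t, p t t)
    (symm : ∀ t s, DEq Γ t s → p t s → p s t)
    (trans : ∀ t s r, DEq Γ t s → DEq Γ s r → p t s → p s r → p t r)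
    (cong : ∀ (n : ℕ) (f : L.Functions n) (ts ss : Fin n → Tm L K), (∀ i, DEq Γ (ts i) (ss i)) →
      (∀ i, p (ts i) (ss i)) → p (Term.func f ts) (Term.func f ss))
    {t s : Tm L K} (h : DEq Γ t s) : p t s := by
  have key : ∀ l, Derives Γ l → ∀ t s, l = .eq t s → p t s := by
    intro l h
    induction h with
    | hyp h => rintro t s rfl; exact hyp t s h
    | refl t => rintro _ _ ⟨⟩; exact refl _
    | symm h ih => rintro _ _ ⟨⟩; exact symm _ _ h (ih _ _ rfl)
    | trans h h' ih ih' => rintro _ _ ⟨⟩; exact trans _ _ _ h h' (ih _ _ rfl) (ih' _ _ rfl)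
    | cong f ts ss h ih => rintro _ _ ⟨⟩; exact cong _ f ts ss h fun i => ih i _ _ rfl
    | ne_symm => rintro _ _ ⟨⟩
    | pmod => rintro _ _ ⟨⟩
  exact key _ h _ _ rfl

theorem DEq.cut {Γ Γ' : Lits L K} (hΓ : ∀ t s, Lit.eq t s ∈ Γ → DEq Γ' t s) {t s : Tm L K}
    (h : DEq Γ t s) : DEq Γ' t s :=
  h.rec_eq hΓ .refl (fun _ _ _ => .symm) (fun _ _ _ _ _ => .trans) (fun _ f _ _ _ => .cong f _ _)

/-- A derivable disequation comes from a disequation in `Γ` by replacing equals by equals. -/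
theorem Derives.exists_of_ne {Γ : Lits L K} {t s : Tm L K} (h : Derives Γ (.ne t s)) :
    ∃ t₀ s₀, Lit.ne t₀ s₀ ∈ Γ ∧ ((DEq Γ t₀ t ∧ DEq Γ s₀ s) ∨ (DEq Γ t₀ s ∧ DEq Γ s₀ t)) := by
  have key : ∀ l, Derives Γ l → ∀ t s, l = .ne t s →
      ∃ t₀ s₀, Lit.ne t₀ s₀ ∈ Γ ∧ ((DEq Γ t₀ t ∧ DEq Γ s₀ s) ∨ (DEq Γ t₀ s ∧ DEq Γ s₀ t)) := by
    intro l h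
    induction h with
    | hyp h => rintro t s rfl; exact ⟨t, s, h, .inl ⟨.refl _, .refl _⟩⟩
    | refl | symm | trans | cong => rintro _ _ ⟨⟩
    | ne_symm h ih =>
      rintro _ _ ⟨⟩
      obtain ⟨t₀, s₀, h₀, h'⟩ := ih _ _ rfl
      exact ⟨t₀, s₀, h₀, h'.symm⟩
    | pmod _ ht hs ih =>
      rintro _ _ ⟨⟩
      obtain ⟨t₀, s₀, h₀, ⟨h₁, h₂⟩ | ⟨h₁, h₂⟩⟩ := ih _ _ rfl
      · exact ⟨t₀, s₀, h₀, .inl ⟨h₁.trans ht, h₂.trans hs⟩⟩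
      · exact ⟨t₀, s₀, h₀, .inr ⟨h₁.trans hs, h₂.trans ht⟩⟩
  exact key _ h _ _ rfl

theorem Derives.of_exists_ne {Γ : Lits L K} {t s t₀ s₀ : Tm L K} (h : Derives Γ (.ne t₀ s₀))
    (h' : (DEq Γ t₀ t ∧ DEq Γ s₀ s) ∨ (DEq Γ t₀ s ∧ DEq Γ s₀ t)) : Derives Γ (.ne t s) := by
  rcases h' with ⟨h₁, h₂⟩ | ⟨h₁, h₂⟩
  · exact h.pmod h₁ h₂
  · exact (h.pmod h₁ h₂).ne_symm

/-- A term that equals an application `f ts` is one with equal arguments, or some application of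
`f` to equal arguments occurs in `Γ`. -/
theorem DEq.exists_func {Γ : Lits L K} {t : Tm L K} {n : ℕ} {f : L.Functions n}
    {ts : Fin n → Tm L K} (h : DEq Γ t (Term.func f ts)) :
    (∃ ss, t = Term.func f ss ∧ ∀ i, DEq Γ (ss i) (ts i)) ∨
      ∃ ss, Term.func f ss ∈ terms Γ ∧ ∀ i, DEq Γ (ss i) (ts i) := by
  let q : Tm L K → Tm L K → Prop := fun t s => ∀ (n : ℕ) (f : L.Functions n) (ts : Fin n → Tm L K),
    s = Term.func f ts → (∃ ss, t = Term.func f ss ∧ ∀ i, DEq Γ (ss i) (ts i)) ∨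
      ∃ ss, Term.func f ss ∈ terms Γ ∧ ∀ i, DEq Γ (ss i) (ts i)
  have qtrans : ∀ t s r, q t s → q s r → q t r := by
    intro t s r h h' n f ts hr
    rcases h' n f ts hr with ⟨ss, hs, hss⟩ | h'
    · rcases h n f ss hs with ⟨rs, ht, hrs⟩ | ⟨rs, ht, hrs⟩
      · exact .inl ⟨rs, ht, fun i => (hrs i).trans (hss i)⟩
      · exact .inr ⟨rs, ht, fun i => (hrs i).trans (hss i)⟩
    · exact .inr h'
  -- The property `q` is transitive but not visibly symmetric, so the induction carries both
  -- orientations.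
  have key : q t (Term.func f ts) ∧ q (Term.func f ts) t := by
    refine h.rec_eq (p := fun t s => q t s ∧ q s t) ?_ ?_ ?_ ?_ ?_
    · intro t s h
      constructor
      · rintro n f ts rfl
        exact .inr ⟨ts, right_mem_terms h, fun _ => .refl _⟩
      · rintro n f ts rfl
        exact .inr ⟨ts, left_mem_terms h, fun _ => .refl _⟩
    · intro t
      have : q t t := by
        rintro n f ts rfl
        exact .inl ⟨ts, rfl, fun _ => .refl _⟩
      exact ⟨this, this⟩
    · rintro t s _ ⟨h, h'⟩
      exact ⟨h', h⟩
    · rintro t s r _ _ ⟨h, h'⟩ ⟨h'', h'''⟩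
      exact ⟨qtrans _ _ _ h h'', qtrans _ _ _ h''' h'⟩
    · intro n f ts ss h _
      constructor
      · rintro _ _ _ ⟨⟩
        exact .inl ⟨ts, rfl, h⟩
      · rintro _ _ _ ⟨⟩
        exact .inl ⟨ss, rfl, fun i => (h i).symm⟩
  exact key.1 n f ts rfl

/-- A constant is not an application, so only the second alternative of `DEq.exists_func` is left.
This confines the relevant applications to occurring ones, up to equality of arguments. -/
theorem DEq.exists_func_of_cst {Γ : Lits L K} {c : Const K} {n : ℕ} {f : L.Functions n}
    {ts : Fin n → Tm L K} (h : DEq Γ (cst c) (Term.func f ts)) :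
    ∃ ss, Term.func f ss ∈ terms Γ ∧ ∀ i, DEq Γ (ss i) (ts i) := by
  rcases h.exists_func with ⟨ss, h, _⟩ | h
  · cases h
  · exact h

/-- A constant that is not a side of an equation in `Γ` is only equal to itself. -/
theorem DEq.eq_of_cst {Γ : Lits L K} {c : Const K}
    (hc : ∀ t s, Lit.eq t s ∈ Γ → t ≠ cst c ∧ s ≠ cst c) {t : Tm L K} (h : DEq Γ (cst c) t) :
    t = cst c := by
  refine (h.rec_eq (p := fun t s => t = cst c ↔ s = cst c) ?_ ?_ ?_ ?_ ?_).1 rfl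
  · intro t s h
    simp [hc t s h]
  · simp
  · intro t s _ h
    exact h.symm
  · intro t s r _ _ h h'
    exact h.trans h'
  · intro n f ts ss _ _
    simp

theorem DEq.subst_right {Γ : Lits L K} {σ : Const K → Tm L K} (h : ∀ c, DEq Γ (cst c) (σ c))
    (t : Tm L K) : DEq Γ t (t.subst σ) := by
  induction t with
  | var c => exact h c
  | func f ts ih => exact .cong f _ _ ih

/-- Used to trade auxiliary or newly defined constants for terms that they provably equal. -/
theorem Derives.subst_iff {Γ : Lits L K} {σ : Const K → Tm L K} (h : ∀ c, DEq Γ (cst c) (σ c))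
    (l : Lit L K) : Derives Γ (l.subst σ) ↔ Derives Γ l := by
  cases l with
  | eq t s =>
    exact ⟨fun h' => ((DEq.subst_right h t).trans h').trans (DEq.subst_right h s).symm,
      fun h' => ((DEq.subst_right h t).symm.trans h').trans (DEq.subst_right h s)⟩
  | ne t s =>
    exact ⟨fun h' => h'.pmod (DEq.subst_right h t).symm (DEq.subst_right h s).symm,
      fun h' => h'.pmod (DEq.subst_right h t) (DEq.subst_right h s)⟩

/-! ## Soundness and completeness -/

theorem realize_congr {M : Type*} [L.Structure M] {ν ν' : Const K → M} {t : Tm L K}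
    (h : ∀ c, Subterm (cst c) t → ν c = ν' c) : t.realize ν = t.realize ν' := by
  induction t with
  | var c => exact h c (.refl _)
  | func f ts ih =>
    simp only [Term.realize]
    congr 1
    ext1 i
    exact ih i fun c hc => h c (.arg f ts i hc)

theorem Lit.Holds.congr {M : Type (max u w)} [L.Structure M] {ν ν' : Const K → M} {l : Lit L K}
    (h : ∀ c ∈ l.consts, ν c = ν' c) (hl : l.Holds ν) : l.Holds ν' := by
  cases l with
  | eq t s =>
    simpa only [Lit.Holds, realize_congr fun c hc => h c (.inl hc),
      realize_congr fun c hc => h c (.inr hc)] using hl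
  | ne t s =>
    simpa only [Lit.Holds, realize_congr fun c hc => h c (.inl hc),
      realize_congr fun c hc => h c (.inr hc)] using hl

theorem Lit.holds_subst {M : Type (max u w)} [L.Structure M] {ν : Const K → M}
    {σ : Const K → Tm L K} {l : Lit L K} :
    (l.subst σ).Holds ν ↔ l.Holds (fun c => (σ c).realize ν) := by
  cases l <;> simp [Lit.subst, Lit.Holds, FirstOrder.Language.Term.realize_subst]

theorem Derives.entails {Γ : Lits L K} {l : Lit L K} (h : Derives Γ l) : Entails Γ l := by
  intro M _ ν hν
  induction h with
  | hyp h => exact hν _ h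
  | refl t => rfl
  | symm _ ih => exact Eq.symm ih
  | trans _ _ ih ih' => exact Eq.trans ih ih'
  | cong f ts ss _ ih =>
    simp only [Lit.Holds, Term.realize] at ih ⊢
    congr 1
    ext1 i
    exact ih i
  | ne_symm _ ih => exact Ne.symm ih
  | pmod _ _ _ ih ih' ih'' =>
    simp only [Lit.Holds] at ih ih' ih'' ⊢
    rwa [← ih', ← ih'']

/-- The term model: its elements include the classes of provably equal terms. -/
@[reducible] def classStructure (Γ : Lits L K) : L.Structure (Set (Tm L K)) where
  funMap f X := {t | ∃ ts, (∀ i, ts i ∈ X i) ∧ DEq Γ (Term.func f ts) t}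
  RelMap _ _ := False

/-- By congruence and transitivity, applying `f` to the classes of the arguments yields exactly the
class of the application. -/
theorem realize_classStructure (Γ : Lits L K) (t : Tm L K) :
    letI := classStructure Γ
    t.realize (fun c => {s | DEq Γ (cst c) s}) = {s | DEq Γ t s} := by
  induction t with
  | var c => rfl
  | func f ts ih =>
    let _ := classStructure Γ
    have : (Term.func f ts).realize (fun c => {s | DEq Γ (cst c) s}) =
        FirstOrder.Language.Structure.funMap f (fun i => {s | DEq Γ (ts i) s}) := by
      simp only [Term.realize]
      congr 1
      ext1 i
      exact ih i
    rw [this]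
    ext s
    constructor
    · rintro ⟨ss, h, h'⟩
      exact Derives.trans (.cong f _ _ h) h'
    · intro h
      exact ⟨ts, fun i => .refl _, h⟩

theorem class_eq_class {Γ : Lits L K} {t s : Tm L K} :
    {r | DEq Γ t r} = {r | DEq Γ s r} ↔ DEq Γ t s := by
  constructor
  · intro h
    exact (Set.ext_iff.1 h s).2 (.refl s)
  · intro h
    ext r
    exact ⟨fun h' => h.symm.trans h', fun h' => h.trans h'⟩

theorem holds_classStructure {Γ : Lits L K}
    (h : ∀ t s, Lit.ne t s ∈ Γ → ¬ DEq Γ t s) :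
    letI := classStructure Γ
    ∀ l ∈ Γ, l.Holds (fun c => {s | DEq Γ (cst c) s}) := by
  intro l hl
  cases l with
  | eq t s =>
    simp only [Lit.Holds, realize_classStructure, class_eq_class]
    exact .hyp hl
  | ne t s =>
    simp only [Lit.Holds, realize_classStructure, class_eq_class, ne_eq]
    exact h t s hl

/-- In the term model all equations of `Γ` hold, and a disequation fails only if its two sides are
provably equal. So one disequation of `Γ` suffices to witness inconsistency. -/
theorem satisfiable_iff {Γ : Lits L K} :
    Satisfiable Γ ↔ ∀ t s, Lit.ne t s ∈ Γ → ¬ DEq Γ t s := by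
  constructor
  · rintro ⟨M, _, ν, hν⟩ t s hne h
    exact hν _ hne (h.entails M ν hν)
  · intro h
    exact ⟨_, classStructure Γ, _, holds_classStructure h⟩

theorem Satisfiable.not_derives_ne {Γ : Lits L K} (hΓ : Satisfiable Γ) (t : Tm L K) :
    ¬ Derives Γ (.ne t t) := by
  obtain ⟨M, _, ν, hν⟩ := hΓ
  intro h
  exact h.entails M ν hν rfl

/-- Completeness for equations: the term model satisfies only the provable ones. -/
theorem Entails.deq {Γ : Lits L K} (hΓ : Satisfiable Γ) {t s : Tm L K}
    (h : Entails Γ (.eq t s)) : DEq Γ t s := by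
  let _ := classStructure Γ
  have := h _ _ (holds_classStructure (satisfiable_iff.1 hΓ))
  simpa only [Lit.Holds, realize_classStructure, class_eq_class] using this

theorem Satisfiable.mono {Γ Γ' : Lits L K} (h : Satisfiable Γ') (hΓ : Γ ⊆ Γ') : Satisfiable Γ := by
  obtain ⟨M, i, ν, hν⟩ := h
  exact ⟨M, i, ν, fun l hl => hν l (hΓ hl)⟩

theorem Satisfiable.image_subst {Γ : Lits L K} {π : Equiv.Perm ℕ} :
    Satisfiable (Lit.subst (auxRename π) '' Γ) ↔ Satisfiable Γ := by
  constructor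
  · rintro ⟨M, i, ν, hν⟩
    exact ⟨M, i, _, fun l hl => Lit.holds_subst.1 (hν _ ⟨l, hl, rfl⟩)⟩
  · rintro ⟨M, i, ν, hν⟩
    refine ⟨M, i, fun c => (auxRename π.symm c : Tm L K).realize ν, ?_⟩
    rintro _ ⟨l, hl, rfl⟩
    rw [← Lit.holds_subst, Lit.subst_auxRename_symm]
    exact hν l hl

end UP

namespace UP

open FirstOrder.Language (Term)

variable {L : FirstOrder.Language.{u, v}} {K : Type w}

/-! ## What a set of literals says about the constants in `V` -/

/-- `R` simulates the consequences of `Γ` about the constants in `V` by consequences of `Γ'`. -/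
structure InterfaceSim (V : Set K) (Γ Γ' : Lits L K) (R : Tm L K → Tm L K → Prop) : Prop where
  refl : ∀ a ∈ V, R (cst (Sum.inl a)) (cst (Sum.inl a))
  eq : ∀ {t t' s s'}, R t t' → R s s' → DEq Γ t s → DEq Γ' t' s'
  ne : ∀ a ∈ V, ∀ b ∈ V, Derives Γ (.ne (cst (Sum.inl a)) (cst (Sum.inl b))) →
    Derives Γ' (.ne (cst (Sum.inl a)) (cst (Sum.inl b)))
  fn : ∀ a ∈ V, ∀ {n : ℕ} (f : L.Functions n) (ts : Fin n → Tm L K), Term.func f ts ∈ terms Γ →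
    DEq Γ (cst (Sum.inl a)) (Term.func f ts) → (∃ j, ∃ b ∈ V, DEq Γ (cst (Sum.inl b)) (ts j)) →
    ∃ ts', (∀ i, R (ts i) (ts' i)) ∧ Term.func f ts' ∈ terms Γ' ∧
      DEq Γ' (cst (Sum.inl a)) (Term.func f ts')

/-- `Γ` and `Γ'` have matching consequences about the constants in `V`. -/
def InterfaceEquiv (V : Set K) (Γ Γ' : Lits L K) : Prop :=
  ∃ R : Tm L K → Tm L K → Prop, InterfaceSim V Γ Γ' R ∧ InterfaceSim V Γ' Γ (fun t s => R s t)

variable {V : Set K} {Γ Γ' Γ'' : Lits L K}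

theorem InterfaceSim.trans {R R' : Tm L K → Tm L K → Prop} (h : InterfaceSim V Γ Γ' R)
    (h' : InterfaceSim V Γ' Γ'' R') :
    InterfaceSim V Γ Γ'' (fun t s => ∃ r, R t r ∧ R' r s) where
  refl a ha := ⟨_, h.refl a ha, h'.refl a ha⟩
  eq := by
    rintro t t' s s' ⟨r, ht, ht'⟩ ⟨r', hs, hs'⟩ hts
    exact h'.eq ht' hs' (h.eq ht hs hts)
  ne a ha b hb hab := h'.ne a ha b hb (h.ne a ha b hb hab)
  fn := by
    rintro a ha n f ts hts hf ⟨j, b, hb, hj⟩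
    obtain ⟨ts', hR, hts', hf'⟩ := h.fn a ha f ts hts hf ⟨j, b, hb, hj⟩
    -- The second matching also needs an argument named by `V`; the first one preserves it because
    -- it relates `b` to itself.
    obtain ⟨ts'', hR', hts'', hf''⟩ := h'.fn a ha f ts' hts' hf'
      ⟨j, b, hb, h.eq (h.refl b hb) (hR j) hj⟩
    exact ⟨ts'', fun i => ⟨_, hR i, hR' i⟩, hts'', hf''⟩

theorem InterfaceSim.congr {R R' : Tm L K → Tm L K → Prop} (h : InterfaceSim V Γ Γ' R)
    (hR : ∀ t s, R t s ↔ R' t s) : InterfaceSim V Γ Γ' R' := by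
  have : R = R' := by ext; exact hR _ _
  rwa [← this]

theorem InterfaceEquiv.symm (h : InterfaceEquiv V Γ Γ') : InterfaceEquiv V Γ' Γ := by
  obtain ⟨R, h, h'⟩ := h
  exact ⟨_, h', h⟩

theorem InterfaceEquiv.trans (h : InterfaceEquiv V Γ Γ') (h' : InterfaceEquiv V Γ' Γ'') :
    InterfaceEquiv V Γ Γ'' := by
  obtain ⟨R, h₁, h₂⟩ := h
  obtain ⟨R', h₁', h₂'⟩ := h'
  exact ⟨_, h₁.trans h₁', (h₂'.trans h₂).congr fun t s => by simp only [and_comm]⟩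

theorem InterfaceSim.anti {V' : Set K} {R : Tm L K → Tm L K → Prop} (h : InterfaceSim V Γ Γ' R)
    (hV : V' ⊆ V) : InterfaceSim V' Γ Γ' R where
  refl a ha := h.refl a (hV ha)
  eq := h.eq
  ne a ha b hb := h.ne a (hV ha) b (hV hb)
  fn a ha _ f ts hts hf hj := h.fn a (hV ha) f ts hts hf
    (hj.imp fun _ hj => hj.imp fun _ hb => ⟨hV hb.1, hb.2⟩)

theorem InterfaceEquiv.anti {V' : Set K} (h : InterfaceEquiv V Γ Γ') (hV : V' ⊆ V) :
    InterfaceEquiv V' Γ Γ' := by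
  obtain ⟨R, h, h'⟩ := h
  exact ⟨R, h.anti hV, h'.anti hV⟩

/-- The matching can be restricted to terms that occur. -/
theorem InterfaceSim.restrict {R : Tm L K → Tm L K → Prop} {A B : Set (Tm L K)}
    (h : InterfaceSim V Γ Γ' R) (hA : terms Γ ⊆ A) (hB : terms Γ' ⊆ B)
    (hVA : ∀ a ∈ V, cst (Sum.inl a) ∈ A) (hVB : ∀ a ∈ V, cst (Sum.inl a) ∈ B) :
    InterfaceSim V Γ Γ' (fun t s => R t s ∧ t ∈ A ∧ s ∈ B) where
  refl a ha := ⟨h.refl a ha, hVA a ha, hVB a ha⟩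
  eq ht hs := h.eq ht.1 hs.1
  ne := h.ne
  fn a ha _ f ts hts hf hj := by
    obtain ⟨ts', hR, hts', hf'⟩ := h.fn a ha f ts hts hf hj
    exact ⟨ts', fun i => ⟨hR i, hA (arg_mem_terms hts i), hB (arg_mem_terms hts' i)⟩, hts', hf'⟩

/-- Provable equality, which is common to both sets, serves as the matching; the occurring
applications are then found by `DEq.exists_func_of_cst`. -/
theorem InterfaceEquiv.of_derives_iff (h : ∀ l, Derives Γ l ↔ Derives Γ' l) :
    InterfaceEquiv V Γ Γ' := by
  have key : ∀ {Γ Γ' : Lits L K}, (∀ l, Derives Γ l ↔ Derives Γ' l) →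
      InterfaceSim V Γ Γ' (DEq Γ) := by
    intro Γ Γ' h
    refine ⟨fun _ _ => .refl _, fun ht hs hts => (h _).1 ((ht.symm.trans hts).trans hs),
      fun _ _ _ _ hab => (h _).1 hab, ?_⟩
    intro a _ n f ts _ hf _
    obtain ⟨ss, hss, hs⟩ := DEq.exists_func_of_cst ((h _).1 hf)
    exact ⟨ss, fun i => (h _).2 (hs i).symm, hss, ((h _).1 hf).trans (.cong f _ _ fun i =>
      (hs i).symm)⟩
  refine ⟨DEq Γ, key h, (key fun l => (h l).symm).congr fun t s => ?_⟩
  exact ⟨fun hts => ((h _).2 hts).symm, fun hts => ((h _).1 hts).symm⟩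

/-- A matching also relates applications that do not occur. -/
theorem InterfaceSim.exists_fn {R : Tm L K → Tm L K → Prop} (h : InterfaceSim V Γ Γ' R) {a : K}
    (ha : a ∈ V) {n : ℕ} {f : L.Functions n} {ts : Fin n → Tm L K}
    (hf : DEq Γ (cst (Sum.inl a)) (Term.func f ts))
    (hj : ∃ j, ∃ b ∈ V, DEq Γ (cst (Sum.inl b)) (ts j)) :
    ∃ ss ss', (∀ i, DEq Γ (ss i) (ts i)) ∧ (∀ i, R (ss i) (ss' i)) ∧ Term.func f ss ∈ terms Γ ∧
      Term.func f ss' ∈ terms Γ' ∧ DEq Γ' (cst (Sum.inl a)) (Term.func f ss') := by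
  obtain ⟨ss, hss, hs⟩ := hf.exists_func_of_cst
  obtain ⟨j, b, hb, hj⟩ := hj
  obtain ⟨ss', hR, hss', hf'⟩ := h.fn a ha f ss hss
    (hf.trans (.cong f _ _ fun i => (hs i).symm)) ⟨j, b, hb, hj.trans (hs j).symm⟩
  exact ⟨ss, ss', hs, hR, hss, hss', hf'⟩

theorem InterfaceSim.deq {R : Tm L K → Tm L K → Prop} (h : InterfaceSim V Γ Γ' R) {a b : K}
    (ha : a ∈ V) (hb : b ∈ V) (hab : DEq Γ (cst (Sum.inl a)) (cst (Sum.inl b))) :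
    DEq Γ' (cst (Sum.inl a)) (cst (Sum.inl b)) := h.eq (h.refl a ha) (h.refl b hb) hab

/-- A derivable equation `a ≈ f(b⃗)` over `V` transfers along a matching. -/
theorem InterfaceSim.deq_fn [IsEmpty (L.Functions 0)] {R : Tm L K → Tm L K → Prop}
    (h : InterfaceSim V Γ Γ' R) {a : K} (ha : a ∈ V) {n : ℕ} {f : L.Functions n} {bs : Fin n → K}
    (hbs : ∀ i, bs i ∈ V) (hf : DEq Γ (cst (Sum.inl a)) (appc f fun i => Sum.inl (bs i))) :
    DEq Γ' (cst (Sum.inl a)) (appc f fun i => Sum.inl (bs i)) := by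
  cases n with
  | zero => exact isEmptyElim f
  | succ n =>
    obtain ⟨ss, ss', hs, hR, -, -, hf'⟩ := h.exists_fn ha hf ⟨0, _, hbs 0, .refl _⟩
    exact hf'.trans (.cong f _ _ fun i => (h.eq (h.refl _ (hbs i)) (hR i) (hs i).symm).symm)

/-- Renaming constants outside `V` does not change the consequences about `V`. -/
theorem InterfaceEquiv.rename (π : Equiv.Perm ℕ) :
    InterfaceEquiv V Γ (Lit.subst (auxRename π) '' Γ) := by
  have forth : ∀ {Γ : Lits L K} {π : Equiv.Perm ℕ} {l : Lit L K}, Derives Γ l →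
      Derives (Lit.subst (auxRename π) '' Γ) (l.subst (auxRename π)) := by
    intro Γ π l h
    exact h.subst fun l hl => .hyp (Set.mem_image_of_mem _ hl)
  have key : ∀ (Γ : Lits L K) (π : Equiv.Perm ℕ),
      InterfaceSim V Γ (Lit.subst (auxRename π) '' Γ) (fun t s => s = t.subst (auxRename π)) := by
    intro Γ π
    refine ⟨fun _ _ => rfl, ?_, fun _ _ _ _ h => forth h, ?_⟩
    · rintro t _ s _ rfl rfl h
      exact forth h
    · intro a _ n f ts hts hf _
      exact ⟨_, fun i => rfl, mem_terms_image_subst hts, forth hf⟩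
  have hΓ : Γ = Lit.subst (auxRename π.symm) '' (Lit.subst (auxRename π) '' Γ) := by
    simp [Set.image_image, Lit.subst_auxRename_symm]
  refine ⟨_, key Γ π, ?_⟩
  have := key (Lit.subst (auxRename π) '' Γ) π.symm
  rw [← hΓ] at this
  refine this.congr fun t s => ⟨?_, ?_⟩
  · rintro rfl
    exact (subst_auxRename_symm π.symm t).symm
  · rintro rfl
    exact (subst_auxRename_symm π s).symm

end UP

namespace UP

open FirstOrder.Language (Term)

variable {L : FirstOrder.Language.{u, v}} {K : Type w} {V : Set K} {W : Set ℕ}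
  {Γ β δ : Lits L K}

/-! ## Shapes -/

theorem inr_notMem_inV {n : ℕ} : (Sum.inr n : Const K) ∉ inV V := by
  rintro ⟨a, _, h⟩; cases h

theorem inl_notMem_inW {a : K} : (Sum.inl a : Const K) ∉ inW W := by
  rintro ⟨n, _, h⟩; cases h

theorem disjoint_inV_inW {c : Const K} (hV : c ∈ inV V) : c ∉ inW W := by
  obtain ⟨a, _, rfl⟩ := hV
  exact inl_notMem_inW

theorem finite_inVW (hV : V.Finite) (hW : W.Finite) : (inVW V W).Finite :=
  (hV.image _).union (hW.image _)

theorem BetaShape.subst {l : Lit L K} {W' : Set ℕ} (h : BetaShape V W l) (π : ℕ → ℕ)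
    (hπ : ∀ n, Sum.inr n ∈ l.consts → π n ∈ W') : BetaShape V W' (l.subst (auxRename π)) := by
  have hmap : ∀ c ∈ inV V, Sum.map id π c = c := by
    rintro _ ⟨a, _, rfl⟩
    rfl
  cases h with
  | eq ha hb => exact .eq ((hmap _ ha).symm ▸ ha) ((hmap _ hb).symm ▸ hb)
  | ne ha hb => exact .ne ((hmap _ ha).symm ▸ ha) ((hmap _ hb).symm ▸ hb)
  | fn f bs ha hbs hj =>
    refine .fn f (fun i => Sum.map id π (bs i)) ((hmap _ ha).symm ▸ ha) (fun i => ?_) ?_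
    · rcases hbs i with h | ⟨n, _, h⟩
      · exact .inl ((hmap _ h).symm ▸ h)
      · refine .inr ⟨π n, hπ n (.inr (.arg f _ i ?_)), by rw [← h]; rfl⟩
        rw [h]
        exact .refl _
    · obtain ⟨j, hj⟩ := hj
      exact ⟨j, (hmap _ hj).symm ▸ hj⟩

theorem appc_inj {n : ℕ} {f g : L.Functions n} {bs cs : Fin n → Const K}
    (h : appc f bs = appc g cs) : bs = cs := by
  obtain ⟨-, -, h⟩ := Term.func.inj h
  ext1 i
  simpa using congrFun (eq_of_heq h) i

theorem BetaShape.fn_inv {c : Const K} {n : ℕ} {f : L.Functions n} {bs : Fin n → Const K}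
    (h : BetaShape V W (.eq (cst c) (appc f bs))) : c ∈ inV V ∧ ∀ i, bs i ∈ inVW V W := by
  generalize hl : Lit.eq (cst c) (appc f bs) = l at h
  cases h with
  | eq => cases (Lit.eq.inj hl).2
  | ne => cases hl
  | fn g cs hc hcs hj =>
    obtain ⟨h₁, h₂⟩ := Lit.eq.inj hl
    obtain rfl := Term.var.inj h₁
    obtain ⟨rfl, -, -⟩ := Term.func.inj h₂
    obtain rfl := appc_inj h₂
    exact ⟨hc, hcs⟩

theorem DeltaShape.fn_inv {c : Const K} {n : ℕ} {f : L.Functions n} {bs : Fin n → Const K}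
    (h : DeltaShape V W (.eq (cst c) (appc f bs))) :
    c ∈ inVW V W ∧ (∀ i, bs i ∈ inVW V W) ∧ (c ∈ inV V → ∀ i, bs i ∈ inW W) := by
  generalize hl : Lit.eq (cst c) (appc f bs) = l at h
  cases h with
  | eq => cases (Lit.eq.inj hl).2
  | ne => cases hl
  | fn g cs hc hcs hW =>
    obtain ⟨h₁, h₂⟩ := Lit.eq.inj hl
    obtain rfl := Term.var.inj h₁
    obtain ⟨rfl, -, -⟩ := Term.func.inj h₂
    obtain rfl := appc_inj h₂
    exact ⟨hc, hcs, hW⟩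

theorem exists_of_func_mem_terms_beta (h : ∀ l ∈ β, BetaShape V W l) {n : ℕ} {f : L.Functions n}
    {ts : Fin n → Tm L K} (hts : Term.func f ts ∈ terms β) :
    ∃ a ∈ V, ∃ bs : Fin n → Const K, (ts = fun i => cst (bs i)) ∧ (∀ i, bs i ∈ inVW V W) ∧
      (∃ j, bs j ∈ inV V) ∧ Lit.eq (cst (Sum.inl a)) (appc f bs) ∈ β := by
  obtain ⟨l, hl, ht⟩ := hts
  have hs := h l hl
  cases hs with
  | eq ha hb => rcases ht with ht | ht <;> simp at ht
  | ne ha hb => rcases ht with ht | ht <;> simp at ht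
  | fn g bs ha hbs hj =>
    rcases ht with ht | ht
    · simp at ht
    · rcases subterm_func.1 ht with ht | ⟨i, ht⟩
      · cases ht
        obtain ⟨a, ha, rfl⟩ := ha
        exact ⟨a, ha, bs, rfl, hbs, hj, hl⟩
      · simp at ht

theorem exists_of_func_mem_terms_union (h : ∀ l ∈ β, BetaShape V W l)
    (h' : ∀ l ∈ δ, DeltaShape V W l) {n : ℕ} {f : L.Functions n}
    {ts : Fin n → Tm L K} (hts : Term.func f ts ∈ terms (β ∪ δ)) :
    ∃ a ∈ inVW V W, ∃ bs : Fin n → Const K, (ts = fun i => cst (bs i)) ∧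
      (∀ i, bs i ∈ inVW V W) ∧ Lit.eq (cst a) (appc f bs) ∈ β ∪ δ := by
  rw [terms_union] at hts
  rcases hts with hts | hts
  · obtain ⟨a, ha, bs, h₁, h₂, -, h₃⟩ := exists_of_func_mem_terms_beta h hts
    exact ⟨_, .inl ⟨a, ha, rfl⟩, bs, h₁, h₂, .inl h₃⟩
  · obtain ⟨l, hl, ht⟩ := hts
    have hs := h' l hl
    cases hs with
    | eq ha hb => rcases ht with ht | ht <;> simp at ht
    | ne ha hb => rcases ht with ht | ht <;> simp at ht
    | fn g bs ha hbs hj =>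
      rcases ht with ht | ht
      · simp at ht
      · rcases subterm_func.1 ht with ht | ⟨i, ht⟩
        · cases ht
          exact ⟨_, ha, bs, rfl, hbs, .inr hl⟩
        · simp at ht

/-- An auxiliary constant of `β` is only equal to itself. -/
theorem eq_of_deq_inr (h : ∀ l ∈ β, BetaShape V W l) {n : ℕ} {t : Tm L K}
    (ht : DEq β (cst (Sum.inr n)) t) : t = cst (Sum.inr n) := by
  refine ht.eq_of_cst fun t s hts => ?_
  have := h _ hts
  cases this with
  | eq ha hb =>
    obtain ⟨a, -, rfl⟩ := ha
    obtain ⟨b, -, rfl⟩ := hb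
    simp
  | fn f bs ha =>
    obtain ⟨a, -, rfl⟩ := ha
    simp

/-- Auxiliary constants enter `β` only next to an argument in `V`. This makes each of them
accessible to the `fn` clause of a matching. -/
theorem exists_fn_of_inr_mem_consts (h : ∀ l ∈ β, BetaShape V W l) {n : ℕ}
    (hn : Sum.inr n ∈ consts β) :
    ∃ a ∈ V, ∃ (m : ℕ) (f : L.Functions m) (bs : Fin m → Const K), (∃ j, bs j ∈ inV V) ∧
      Lit.eq (cst (Sum.inl a)) (appc f bs) ∈ β ∧ ∃ i, bs i = Sum.inr n := by
  obtain ⟨l, hl, ht⟩ := hn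
  have hs := h l hl
  cases hs with
  | eq ha hb =>
    obtain ⟨a, -, rfl⟩ := ha
    obtain ⟨b, -, rfl⟩ := hb
    rcases ht with ht | ht <;> simp at ht
  | ne ha hb =>
    obtain ⟨a, -, rfl⟩ := ha
    obtain ⟨b, -, rfl⟩ := hb
    rcases ht with ht | ht <;> simp at ht
  | fn f bs ha hbs hj =>
    obtain ⟨a, ha, rfl⟩ := ha
    rcases ht with ht | ht
    · simp at ht
    · obtain ⟨i, ht⟩ := subterm_cst_func.1 ht
      simp only [subterm_var, Term.var.injEq] at ht
      exact ⟨a, ha, _, f, bs, hj, hl, i, ht.symm⟩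

theorem mem_of_inl_mem_consts (h : ∀ l ∈ β, BetaShape V W l) {a : K}
    (ha : Sum.inl a ∈ consts β) : a ∈ V := by
  have inV_iff : ∀ {c : Const K}, cst (L := L) (Sum.inl a) = cst c → c ∈ inVW V W → a ∈ V := by
    intro c hc hcV
    obtain rfl : Sum.inl a = c := by simpa using hc
    simpa [inV, inVW, inW] using hcV
  obtain ⟨l, hl, ht⟩ := ha
  have hs := h l hl
  cases hs with
  | eq hc hd | ne hc hd =>
    rcases ht with ht | ht
    · exact inV_iff (subterm_var.1 ht) (.inl hc)
    · exact inV_iff (subterm_var.1 ht) (.inl hd)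
  | fn f bs hc hd =>
    rcases ht with ht | ht
    · exact inV_iff (subterm_var.1 ht) (.inl hc)
    · obtain ⟨i, ht⟩ := subterm_cst_func.1 ht
      exact inV_iff (subterm_var.1 ht) (hd i)

/-! ## Bases and matchings -/

namespace IsBasis

/-- Between constants of `V` this is completeness of `β`. All other equalities between different
names are excluded by `not_V` and `injective`. -/
theorem deq_beta (h : IsBasis Γ V W β δ) {c d : Const K} (hc : c ∈ inVW V W)
    (hd : d ∈ inVW V W) (hcd : DEq (β ∪ δ) (cst c) (cst d)) : DEq β (cst c) (cst d) := by
  rcases hc with hc | hc <;> rcases hd with hd | hd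
  · exact h.complete _ (.eq hc hd) hcd
  · obtain ⟨a, ha, rfl⟩ := hc
    obtain ⟨n, hn, rfl⟩ := hd
    exact (h.not_V a ha n hn hcd).elim
  · obtain ⟨a, ha, rfl⟩ := hd
    obtain ⟨n, hn, rfl⟩ := hc
    exact (h.not_V a ha n hn hcd.symm).elim
  · obtain ⟨m, hm, rfl⟩ := hd
    obtain ⟨n, hn, rfl⟩ := hc
    by_cases hmn : n = m
    · subst hmn
      exact .refl _
    · exact (h.injective n hn m hm hmn hcd).elim

theorem interfaceEquiv_union (h : IsBasis Γ V W β δ) : InterfaceEquiv V (β ∪ δ) β := by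
  have mono : ∀ {l}, Derives β l → Derives (β ∪ δ) l := Derives.mono Set.subset_union_left
  -- Terms are matched when they share a name `c` in `V ∪ W`, each judged by its own set of
  -- literals.
  refine ⟨fun t t' => ∃ c ∈ inVW V W, DEq (β ∪ δ) t (cst c) ∧ DEq β t' (cst c),
    ⟨?_, ?_, ?_, ?_⟩, ⟨?_, ?_, ?_, ?_⟩⟩
  · intro a ha
    exact ⟨_, .inl ⟨a, ha, rfl⟩, .refl _, .refl _⟩
  · rintro t t' s s' ⟨c, hc, h₁, h₂⟩ ⟨d, hd, h₃, h₄⟩ hts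
    exact (h₂.trans (h.deq_beta hc hd ((h₁.symm.trans hts).trans h₃))).trans h₄.symm
  · intro a ha b hb hab
    exact h.complete _ (.ne ⟨a, ha, rfl⟩ ⟨b, hb, rfl⟩) hab
  · rintro a ha n f ts hts hf ⟨j, b, hb, hj⟩
    obtain ⟨-, -, bs, rfl, hbs, -⟩ := exists_of_func_mem_terms_union h.shape_β h.shape_δ hts
    -- An argument equal to a constant of `V` cannot be auxiliary, so the literal is expressible in
    -- `β`.
    have hbj : bs j ∈ inV V := by
      refine (hbs j).resolve_right ?_
      rintro ⟨m, hm, hmj⟩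
      exact h.not_V b hb m hm (by rw [hmj]; exact hj)
    have hf' := h.complete _ (.fn f bs ⟨a, ha, rfl⟩ hbs ⟨j, hbj⟩) hf
    obtain ⟨ss, hss, hs⟩ := DEq.exists_func_of_cst hf'
    exact ⟨ss, fun i => ⟨bs i, hbs i, .refl _, hs i⟩, hss,
      hf'.trans (.cong f _ _ fun i => (hs i).symm)⟩
  · intro a ha
    exact ⟨_, .inl ⟨a, ha, rfl⟩, .refl _, .refl _⟩
  · rintro t t' s s' ⟨c, hc, h₁, h₂⟩ ⟨d, hd, h₃, h₄⟩ hts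
    exact (h₁.trans (mono ((h₂.symm.trans hts).trans h₄))).trans h₃.symm
  · intro a ha b hb hab
    exact mono hab
  · rintro a ha n f ts hts hf -
    obtain ⟨-, -, bs, rfl, hbs, -⟩ := exists_of_func_mem_terms_beta h.shape_β hts
    exact ⟨_, fun i => ⟨bs i, hbs i, .refl _, .refl _⟩, terms_mono Set.subset_union_left hts,
      mono hf⟩

/-- The constants of `W` can be replaced by terms of `Γ` that they name. -/
theorem exists_subst (h : IsBasis Γ V W β δ) :
    ∃ σ : Const K → Tm L K, (∀ c ∉ inW W, σ c = cst c) ∧ (∀ n ∈ W, σ (Sum.inr n) ∈ terms Γ) ∧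
      ∀ l, Derives (β ∪ δ) l ↔ Derives Γ (l.subst σ) := by
  have : Nonempty (Tm L K) := ⟨cst (Sum.inr 0)⟩
  choose! τ hτ hτ' using h.names
  -- The left branch of `Sum.elim` is a dummy, since `inW W` contains only auxiliary constants.
  let σ : Const K → Tm L K := fun c => open Classical in
    if c ∈ inW W then Sum.elim (fun a => cst (Sum.inl a)) τ c else cst c
  have hσ : ∀ c ∉ inW W, σ c = cst c := fun c hc => if_neg hc
  have hσ' : ∀ n ∈ W, σ (Sum.inr n) = τ n := fun n hn => if_pos ⟨n, hn, rfl⟩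
  have hd : ∀ c, DEq (β ∪ δ) (cst c) (σ c) := by
    intro c
    by_cases hc : c ∈ inW W
    · obtain ⟨n, hn, rfl⟩ := hc
      rw [hσ' n hn]
      exact hτ' n hn
    · rw [hσ c hc]
      exact .refl _
  refine ⟨σ, hσ, fun n hn => hσ' n hn ▸ hτ n hn, fun l => ?_⟩
  rw [← h.derives_iff, Derives.subst_iff hd]
  rw [Set.disjoint_left]
  intro c hc hcW
  obtain ⟨d, hd, hcd⟩ := Lit.mem_consts_subst hc
  obtain ⟨m, hm, rfl⟩ := hcW
  by_cases hdW : d ∈ inW W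
  · obtain ⟨n, hn, rfl⟩ := hdW
    rw [hσ' n hn] at hcd
    exact h.fresh m hm (hcd.mem_terms (hτ n hn))
  · rw [hσ d hdW, subterm_var] at hcd
    obtain rfl : Sum.inr m = d := by simpa using hcd
    exact hdW ⟨m, hm, rfl⟩

/-- Replacing each auxiliary constant by a term it names translates derivability from `β ∪ δ` into
derivability from `Γ`. The matching relates a term to those whose translation it equals. -/
theorem interfaceEquiv_of_union (h : IsBasis Γ V W β δ) : InterfaceEquiv V Γ (β ∪ δ) := by
  obtain ⟨σ, hσ, -, hd⟩ := h.exists_subst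
  have hV : ∀ a : K, σ (Sum.inl a) = cst (Sum.inl a) := fun a => hσ _ inl_notMem_inW
  have hΓ : ∀ c ∈ consts Γ, σ c = cst c := by
    intro c hc
    refine hσ c ?_
    rintro ⟨n, hn, rfl⟩
    exact h.fresh n hn hc
  refine ⟨fun t t' => DEq Γ t (t'.subst σ), ⟨?_, ?_, ?_, ?_⟩, ⟨?_, ?_, ?_, ?_⟩⟩
  · intro a _
    simp only [Term.subst, hV]
    exact .refl _
  · intro t t' s s' h₁ h₂ hts
    exact (hd _).2 ((h₁.symm.trans hts).trans h₂)
  · intro a _ b _ hab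
    refine (hd _).2 ?_
    simpa only [Lit.subst, Term.subst, hV] using hab
  · intro a _ n f ts hts hf _
    have hf' : DEq (β ∪ δ) (cst (Sum.inl a)) (Term.func f ts) := by
      refine (hd _).2 ?_
      rw [Lit.subst, subst_eq_self_of_mem hΓ hts]
      simpa only [Term.subst, hV] using hf
    obtain ⟨ss, hss, hs⟩ := hf'.exists_func_of_cst
    refine ⟨ss, fun i => ?_, hss, hf'.trans (.cong f _ _ fun i => (hs i).symm)⟩
    have := (hd _).1 (hs i).symm
    rwa [Lit.subst, subst_eq_self_of_mem hΓ (arg_mem_terms hts i)] at this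
  · intro a _
    simp only [Term.subst, hV]
    exact .refl _
  · intro t t' s s' h₁ h₂ hts
    exact (h₁.trans ((hd _).1 hts)).trans h₂.symm
  · intro a _ b _ hab
    simpa only [Lit.subst, Term.subst, hV] using (hd _).1 hab
  · intro a _ n f ts _ hf _
    have hf' := (hd _).1 hf
    simp only [Lit.subst, Term.subst, hV] at hf'
    obtain ⟨ss, hss, hs⟩ := DEq.exists_func_of_cst hf'
    exact ⟨ss, hs, hss, hf'.trans (.cong f _ _ fun i => (hs i).symm)⟩

theorem interfaceEquiv (h : IsBasis Γ V W β δ) : InterfaceEquiv V Γ β :=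
  h.interfaceEquiv_of_union.trans h.interfaceEquiv_union

end IsBasis

/-! ## Construction of bases -/

/-- `σ` maps the constants of `W` to representatives of the classes of terms of `Γ` that are not
named by constants in `V`. -/
structure IsNaming (Γ : Lits L K) (V : Set K) (W : Set ℕ) (σ : Const K → Tm L K) : Prop where
  finite : W.Finite
  fresh : ∀ n ∈ W, Sum.inr n ∉ consts Γ
  eq_cst : ∀ c ∉ inW W, σ c = cst c
  mem_terms : ∀ n ∈ W, σ (Sum.inr n) ∈ terms Γ
  not_V : ∀ a ∈ V, ∀ n ∈ W, ¬ DEq Γ (cst (Sum.inl a)) (σ (Sum.inr n))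
  injective : ∀ n ∈ W, ∀ m ∈ W, DEq Γ (σ (Sum.inr n)) (σ (Sum.inr m)) → n = m
  cover : ∀ t ∈ terms Γ, ∃ c ∈ inVW V W, DEq Γ (σ c) t

/-- The finitely many classes of occurring terms are numbered injectively by auxiliary constants not
in `Γ`. Only the numbers of classes without a constant of `V` are kept, each with one
representative. -/
theorem exists_isNaming (hΓ : Γ.Finite) (V : Set K) : ∃ W σ, IsNaming Γ V W σ := by
  have hinf : {n : ℕ | (Sum.inr n : Const K) ∉ consts Γ}.Infinite := by
    have : {n : ℕ | (Sum.inr n : Const K) ∈ consts Γ}.Finite :=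
      (finite_consts hΓ).preimage Sum.inr_injective.injOn
    exact this.infinite_compl
  let C : Set (Set (Tm L K)) := (fun t => {s | DEq Γ t s}) '' terms Γ
  have hC : C.Finite := (finite_terms hΓ).image _
  obtain ⟨e, he⟩ := Set.countable_iff_exists_injOn.1 hC.countable
  -- The number depends only on the class, so equal terms receive the same auxiliary constant.
  let num : Tm L K → ℕ := fun t => hinf.natEmbedding _ (e {s | DEq Γ t s})
  have num_eq : ∀ t ∈ terms Γ, ∀ s ∈ terms Γ, num t = num s → DEq Γ t s := by
    intro t ht s hs h
    have h' := (hinf.natEmbedding _).injective (Subtype.ext h)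
    exact class_eq_class.1 (he ⟨t, ht, rfl⟩ ⟨s, hs, rfl⟩ h')
  have eq_num : ∀ t s, DEq Γ t s → num t = num s := by
    intro t s h
    simp only [num, class_eq_class.2 h]
  let W : Set ℕ := num '' {t | t ∈ terms Γ ∧ ∀ a ∈ V, ¬ DEq Γ (cst (Sum.inl a)) t}
  have hW : ∀ n ∈ W, ∃ t, (t ∈ terms Γ ∧ ∀ a ∈ V, ¬ DEq Γ (cst (Sum.inl a)) t) ∧ num t = n :=
    fun n hn => hn
  have : Nonempty (Tm L K) := ⟨cst (Sum.inr 0)⟩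
  choose! τ hτ hτ' using hW
  let σ : Const K → Tm L K := fun c => open Classical in
    if c ∈ inW W then Sum.elim (fun a => cst (Sum.inl a)) τ c else cst c
  have hσ : ∀ c ∉ inW W, σ c = cst c := fun c hc => if_neg hc
  have hσ' : ∀ n ∈ W, σ (Sum.inr n) = τ n := fun n hn => if_pos ⟨n, hn, rfl⟩
  refine ⟨W, σ, ((finite_terms hΓ).subset fun t ht => ht.1).image _, ?_, hσ, ?_, ?_, ?_, ?_⟩
  · rintro _ ⟨t, -, rfl⟩
    exact (hinf.natEmbedding _ (e {s | DEq Γ t s})).2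
  · intro n hn
    rw [hσ' n hn]
    exact (hτ n hn).1
  · intro a ha n hn
    rw [hσ' n hn]
    exact (hτ n hn).2 a ha
  · intro n hn m hm h
    rw [hσ' n hn, hσ' m hm] at h
    rw [← hτ' n hn, ← hτ' m hm]
    exact eq_num _ _ h
  · intro t ht
    by_cases h : ∃ a ∈ V, DEq Γ (cst (Sum.inl a)) t
    · obtain ⟨a, ha, h⟩ := h
      exact ⟨_, .inl ⟨a, ha, rfl⟩, by rwa [hσ _ inl_notMem_inW]⟩
    · push Not at h
      have hn : num t ∈ W := ⟨t, ⟨ht, h⟩, rfl⟩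
      refine ⟨_, .inr ⟨_, hn, rfl⟩, ?_⟩
      rw [hσ' _ hn]
      exact num_eq _ (hτ _ hn).1 _ ht (hτ' _ hn)

/-- The signature may be infinite; finiteness comes from taking the function symbols from heads of
terms in the finite set `T`. -/
theorem finite_flat_eqs {S : Set (Const K)} {T : Set (Tm L K)} (hS : S.Finite) (hT : T.Finite) :
    {l : Lit L K | ∃ a ∈ S, ∃ (n : ℕ) (f : L.Functions n) (bs : Fin n → Const K),
      (∀ i, bs i ∈ S) ∧ (∃ ts, Term.func f ts ∈ T) ∧ l = .eq (cst a) (appc f bs)}.Finite := by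
  have : ∀ t : Tm L K, {s : Tm L K | ∃ (n : ℕ) (f : L.Functions n) (bs : Fin n → Const K),
      (∀ i, bs i ∈ S) ∧ (∃ ts, Term.func f ts = t) ∧ s = appc f bs}.Finite := by
    intro t
    cases t with
    | var c => simp
    | @func n f ts =>
      refine ((Set.Finite.pi' fun _ : Fin n => hS).image fun bs => appc f bs).subset ?_
      rintro s ⟨m, g, bs, hbs, ⟨ss, h⟩, rfl⟩
      cases h
      exact ⟨bs, hbs, rfl⟩
  refine ((hS.prod (hT.biUnion fun t _ => this t)).image fun p => Lit.eq (cst p.1) p.2).subset ?_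
  rintro l ⟨a, ha, n, f, bs, hbs, ⟨ts, hts⟩, rfl⟩
  refine ⟨(a, appc f bs), ⟨ha, ?_⟩, rfl⟩
  simp only [Set.mem_iUnion]
  exact ⟨_, hts, n, f, bs, hbs, ⟨ts, rfl⟩, rfl⟩

namespace IsNaming

variable {σ : Const K → Tm L K}

theorem inl (h : IsNaming Γ V W σ) (a : K) : σ (Sum.inl a) = cst (Sum.inl a) :=
  h.eq_cst _ inl_notMem_inW

theorem eq_of_mem_inV (h : IsNaming Γ V W σ) {c : Const K} (hc : c ∈ inV V) : σ c = cst c :=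
  h.eq_cst _ (disjoint_inV_inW hc)

theorem eq_of_mem_consts (h : IsNaming Γ V W σ) : ∀ c ∈ consts Γ, σ c = cst c := by
  refine fun c hc => h.eq_cst c ?_
  rintro ⟨n, hn, rfl⟩
  exact h.fresh n hn hc

/-- Only constants of `V` can be redundant names: an auxiliary constant is the sole name of its
class. -/
theorem eq_or_mem (h : IsNaming Γ V W σ) {c d : Const K} (hc : c ∈ inVW V W)
    (hd : d ∈ inVW V W) (hcd : DEq Γ (σ c) (σ d)) : c = d ∨ c ∈ inV V ∧ d ∈ inV V := by
  rcases hc with hc | ⟨n, hn, rfl⟩ <;> rcases hd with hd | ⟨m, hm, rfl⟩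
  · exact .inr ⟨hc, hd⟩
  · obtain ⟨a, ha, rfl⟩ := hc
    rw [h.inl] at hcd
    exact (h.not_V a ha m hm hcd).elim
  · obtain ⟨a, ha, rfl⟩ := hd
    rw [h.inl] at hcd
    exact (h.not_V a ha n hn hcd.symm).elim
  · exact .inl (congrArg _ (h.injective n hn m hm hcd))

/-- A derivable equation `σ c ≈ f(…)` forces an application of `f` to occur in `Γ`, so only finitely
many `f` are possible. -/
theorem finite_fn (h : IsNaming Γ V W σ) (hΓ : Γ.Finite) (hV : V.Finite) :
    {l : Lit L K | ∃ a ∈ inVW V W, ∃ (n : ℕ) (f : L.Functions n) (bs : Fin n → Const K),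
      (∀ i, bs i ∈ inVW V W) ∧ Derives Γ (l.subst σ) ∧ l = .eq (cst a) (appc f bs)}.Finite := by
  refine (finite_flat_eqs (finite_inVW hV h.finite) (finite_terms hΓ)).subset ?_
  rintro l ⟨a, ha, n, f, bs, hbs, hl, rfl⟩
  refine ⟨a, ha, n, f, bs, hbs, ?_, rfl⟩
  simp only [Lit.subst, Term.subst] at hl
  rcases DEq.exists_func hl with ⟨ss, hs, -⟩ | ⟨ss, hs, -⟩
  · refine ⟨ss, ?_⟩
    rcases ha with ha | ⟨n, hn, rfl⟩
    · rw [h.eq_of_mem_inV ha] at hs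
      cases hs
    · rw [← hs]
      exact h.mem_terms n hn
  · exact ⟨ss, hs⟩

theorem finite_beta (h : IsNaming Γ V W σ) (hΓ : Γ.Finite) (hV : V.Finite) :
    {l : Lit L K | BetaShape V W l ∧ Derives Γ (l.subst σ)}.Finite := by
  have hV' : (inV V).Finite := hV.image _
  refine ((((hV'.prod hV').image fun p => Lit.eq (cst p.1) (cst p.2)).union
    ((hV'.prod hV').image fun p => Lit.ne (cst p.1) (cst p.2))).union (h.finite_fn hΓ hV)).subset ?_
  rintro l ⟨hs, hl⟩
  cases hs with
  | eq ha hb => exact .inl (.inl ⟨(_, _), ⟨ha, hb⟩, rfl⟩)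
  | ne ha hb => exact .inl (.inr ⟨(_, _), ⟨ha, hb⟩, rfl⟩)
  | fn f bs ha hbs hj => exact .inr ⟨_, .inl ha, _, f, bs, hbs, hl, rfl⟩

theorem finite_delta (h : IsNaming Γ V W σ) (hΓ : Γ.Finite) (hV : V.Finite) :
    {l : Lit L K | DeltaShape V W l ∧ Derives Γ (l.subst σ)}.Finite := by
  have hVW := finite_inVW hV h.finite
  refine ((((hVW.prod (finite_consts hΓ)).image fun p => Lit.eq (cst p.1) (cst p.2)).union
    ((hVW.prod hVW).image fun p => Lit.ne (cst p.1) (cst p.2))).union (h.finite_fn hΓ hV)).subset ?_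
  rintro l ⟨hs, hl⟩
  cases hs with
  | @eq a b ha hb =>
    refine .inl (.inl ⟨(_, _), ⟨ha, ?_⟩, rfl⟩)
    -- A constant that does not occur in `Γ` equals only itself. Then `σ a` would be `b`, making `b`
    -- a constant of `V` or an occurring one.
    by_contra hbΓ
    have hl : DEq Γ (σ a) (σ b) := hl
    rw [h.eq_cst b fun hbW => hb (.inr hbW)] at hl
    have hab : σ a = cst b := by
      refine DEq.eq_of_cst (fun t s hts => ⟨?_, ?_⟩) hl.symm
      · rintro rfl
        exact hbΓ (left_mem_terms hts)
      · rintro rfl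
        exact hbΓ (right_mem_terms hts)
    rcases ha with ha | ⟨n, hn, rfl⟩
    · rw [h.eq_of_mem_inV ha] at hab
      obtain rfl : a = b := by simpa using hab
      exact hb (.inl ha)
    · have := h.mem_terms n hn
      rw [hab] at this
      exact hbΓ this
  | ne ha hb => exact .inl (.inr ⟨(_, _), ⟨.inr ha, hb⟩, rfl⟩)
  | fn f bs ha hbs hj => exact .inr ⟨_, ha, _, f, bs, hbs, hl, rfl⟩

/-- With `δ` taken to be all sound literals of its shape, every occurring term gets a name that `β ∪
δ` proves equal to it, by induction on the term. Hence `β ∪ δ` proves `Γ`, and derivability from it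
is derivability from `Γ` after applying `σ`. Only soundness and completeness of `β` are assumed, so
that the lemma applies to the maximal `β` as well as to a given one. -/
theorem isBasis (h : IsNaming Γ V W σ) (hΓ : Γ.Finite) (hV : V.Finite) (hβ : β.Finite)
    (shape : ∀ l ∈ β, BetaShape V W l) (sound : ∀ l ∈ β, Derives Γ (l.subst σ))
    (complete : ∀ l, BetaShape V W l → Derives Γ (l.subst σ) → Derives β l) :
    IsBasis Γ V W β {l | DeltaShape V W l ∧ Derives Γ (l.subst σ)} := by
  set δ : Lits L K := {l | DeltaShape V W l ∧ Derives Γ (l.subst σ)} with hδ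
  have mono : ∀ {l}, Derives β l → Derives (β ∪ δ) l := Derives.mono Set.subset_union_left
  have sound' : ∀ l ∈ β ∪ δ, Derives Γ (l.subst σ) := by
    rintro l (hl | hl)
    · exact sound l hl
    · exact hl.2
  have cover : ∀ t ∈ terms Γ, ∃ c ∈ inVW V W, DEq Γ (σ c) t ∧ DEq (β ∪ δ) (cst c) t := by
    intro t ht
    induction t with
    | var c =>
      by_cases hc : c ∈ inVW V W
      · exact ⟨c, hc, by rw [h.eq_of_mem_consts c ht]; exact .refl _, .refl _⟩
      · obtain ⟨d, hd, hdc⟩ := h.cover _ ht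
        refine ⟨d, hd, hdc, .hyp (.inr ⟨.eq hd hc, ?_⟩)⟩
        simpa only [Lit.subst, Term.subst, h.eq_of_mem_consts c ht] using hdc
    | func f ts ih =>
      obtain ⟨d, hd, hdt⟩ := h.cover _ ht
      choose c hc hct hct' using fun i => ih i (arg_mem_terms ht i)
      refine ⟨d, hd, hdt, Derives.trans (s := appc f c) ?_ (.cong f _ _ hct')⟩
      have hl : Derives Γ (Lit.subst σ (.eq (cst d) (appc f c))) := by
        exact hdt.trans (.cong f _ _ fun i => (hct i).symm)
      -- The flat equation has the shape of `β` exactly if its value and some argument lie in `V`;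
      -- otherwise it has the shape of `δ`.
      by_cases hj : d ∈ inV V ∧ ∃ j, c j ∈ inV V
      · exact mono (complete _ (.fn f c hj.1 hc hj.2) hl)
      · refine .hyp (.inr ⟨.fn f c hd hc fun hdV i => ?_, hl⟩)
        exact (hc i).resolve_left fun hi => hj ⟨hdV, i, hi⟩
  have lits : ∀ l ∈ Γ, Derives (β ∪ δ) l := by
    intro l hl
    cases l with
    | eq t s =>
      obtain ⟨c, hc, hct, hct'⟩ := cover t ⟨_, hl, .inl (.refl _)⟩
      obtain ⟨d, hd, hds, hds'⟩ := cover s ⟨_, hl, .inr (.refl _)⟩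
      have hcd := (hct.trans (.hyp hl)).trans hds.symm
      refine (hct'.symm.trans ?_).trans hds'
      rcases h.eq_or_mem hc hd hcd with rfl | ⟨hc, hd⟩
      · exact .refl _
      · exact mono (complete _ (.eq hc hd) hcd)
    | ne t s =>
      obtain ⟨c, hc, hct, hct'⟩ := cover t ⟨_, hl, .inl (.refl _)⟩
      obtain ⟨d, hd, hds, hds'⟩ := cover s ⟨_, hl, .inr (.refl _)⟩
      have hcd : Derives Γ (.ne (σ c) (σ d)) := (Derives.hyp hl).pmod hct.symm hds.symm
      refine Derives.pmod ?_ hct' hds'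
      by_cases hcW : c ∈ inW W
      · exact .hyp (.inr ⟨.ne hcW hd, hcd⟩)
      · by_cases hdW : d ∈ inW W
        · exact .ne_symm (.hyp (.inr ⟨.ne hdW hc, hcd.ne_symm⟩))
        · exact mono (complete _ (.ne (hc.resolve_right hcW) (hd.resolve_right hdW)) hcd)
  have hd : ∀ c, DEq (β ∪ δ) (cst c) (σ c) := by
    intro c
    by_cases hc : c ∈ inW W
    · obtain ⟨n, hn, rfl⟩ := hc
      obtain ⟨d, hd, h₁, h₂⟩ := cover _ (h.mem_terms n hn)
      rcases h.eq_or_mem hd (.inr ⟨n, hn, rfl⟩) h₁ with rfl | ⟨-, h₃⟩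
      · exact h₂
      · exact (inr_notMem_inV h₃).elim
    · rw [h.eq_cst c hc]
      exact .refl _
  have iff : ∀ l, Derives (β ∪ δ) l ↔ Derives Γ (l.subst σ) := fun l =>
    ⟨fun hl => hl.subst sound', fun hl => (Derives.subst_iff hd l).1 (hl.cut lits)⟩
  refine ⟨h.finite, hβ, h.finite_delta hΓ hV, h.fresh, ?_, ?_, shape, fun l hl => hl.1, ?_, ?_, ?_,
    fun l hl hl' => complete l hl ((iff l).1 hl')⟩
  · intro M _ ν
    constructor
    · rintro ⟨ν', hν', hl⟩ l hlΓ
      refine ((lits l hlΓ).entails M ν' hl).congr fun c hc => hν' c ?_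
      rintro ⟨n, hn, rfl⟩
      exact h.fresh n hn ⟨l, hlΓ, hc⟩
    · intro hν
      -- An auxiliary constant is interpreted by the value of the term it stands for.
      refine ⟨fun c => (σ c).realize ν, fun c hc => ?_, fun l hl => ?_⟩
      · simp [h.eq_cst c hc]
      · exact Lit.holds_subst.1 ((sound' l hl).entails M ν hν)
  · intro l hl
    rw [iff, Lit.subst_eq_self]
    exact fun c hc => h.eq_cst c (Set.disjoint_left.1 hl hc)
  · intro a ha n hn hl
    have := (iff _).1 hl
    simp only [Lit.subst, Term.subst, h.inl] at this
    exact h.not_V a ha n hn this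
  · intro n hn m hm hnm hl
    exact hnm (h.injective n hn m hm ((iff _).1 hl))
  · intro n hn
    exact ⟨_, h.mem_terms n hn, hd _⟩

end IsNaming

theorem exists_isBase (hΓ : Γ.Finite) (hV : V.Finite) : ∃ β, IsBase Γ V β := by
  obtain ⟨W, σ, h⟩ := exists_isNaming hΓ V
  exact ⟨_, 1, W, _, _, h.isBasis hΓ hV (h.finite_beta hΓ hV) (fun l hl => hl.1)
    (fun l hl => hl.2) (fun l hl hl' => .hyp ⟨hl, hl'⟩), rfl⟩

/-! ### Bases are the matching sets of the right shape; base abstractions -/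

theorem rename_image_eq (π : Equiv.Perm ℕ) (β : Lits L K) :
    Lit.rename π '' β = Lit.subst (auxRename π) '' β :=
  Set.image_congr fun l _ => Lit.rename_eq_subst π l

theorem IsBase.interfaceEquiv (h : IsBase Γ V β) : InterfaceEquiv V Γ β := by
  obtain ⟨π, W, β', δ, h, rfl⟩ := h
  rw [rename_image_eq]
  exact h.interfaceEquiv.trans (.rename π)

theorem IsBase.finite (h : IsBase Γ V β) : β.Finite := by
  obtain ⟨π, W, β', δ, h, rfl⟩ := h
  exact h.finite_β.image _

theorem IsBase.shape (h : IsBase Γ V β) : ∀ l ∈ β, BetaShape V Set.univ l := by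
  obtain ⟨π, W, β', δ, h, rfl⟩ := h
  rintro _ ⟨l, hl, rfl⟩
  rw [Lit.rename_eq_subst]
  exact (h.shape_β l hl).subst π fun _ _ => trivial

/-- Bases are closed under permutations only, so an injective renaming of finitely many constants
has to be extended to one. -/
theorem exists_perm_eqOn {S : Set ℕ} (hS : S.Finite) {φ : ℕ → ℕ} (hφ : S.InjOn φ) :
    ∃ π : Equiv.Perm ℕ, ∀ n ∈ S, π n = φ n := by
  have := hS.to_subtype
  obtain ⟨π, hπ⟩ := Equiv.Perm.exists_extending_pair (fun n : S => (n : ℕ)) (fun n : S => φ n)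
    Subtype.val_injective (Set.injOn_iff_injective.1 hφ)
  exact ⟨π, fun n hn => hπ ⟨n, hn⟩⟩

/-- The bases of `Γ` are the finite sets of literals of the right shape that match `Γ` on `V`. -/
theorem InterfaceEquiv.isBase (h : InterfaceEquiv V Γ β) (hΓ : Γ.Finite) (hV : V.Finite)
    (hβ : β.Finite) (shape : ∀ l ∈ β, BetaShape V Set.univ l) : IsBase Γ V β := by
  obtain ⟨R, hR, hR'⟩ := h
  obtain ⟨W, σ, hσ⟩ := exists_isNaming hΓ V
  -- An auxiliary constant of `β` is matched with an argument occurring in `Γ`. The name of that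
  -- argument is not in `V`, for otherwise `β` would prove the auxiliary constant equal to a
  -- constant of `V`.
  have hex : ∀ n, Sum.inr n ∈ consts β →
      ∃ m ∈ W, ∃ t, R t (cst (Sum.inr n)) ∧ DEq Γ (σ (Sum.inr m)) t := by
    intro n hn
    obtain ⟨a, ha, m, f, bs, ⟨j, b, hb, hj⟩, hl, i, hi⟩ := exists_fn_of_inr_mem_consts shape hn
    obtain ⟨ts, hts, hmem, -⟩ := hR'.fn a ha f _ (right_mem_terms hl) (.hyp hl)
      ⟨j, b, hb, by rw [hj]; exact .refl _⟩
    have hRi := hts i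
    rw [hi] at hRi
    obtain ⟨c, hc, hct⟩ := hσ.cover _ (arg_mem_terms hmem i)
    rcases hc with ⟨b, hb, rfl⟩ | ⟨k, hk, rfl⟩
    · rw [hσ.inl] at hct
      have := eq_of_deq_inr shape (hR.eq (hR.refl b hb) hRi hct).symm
      simp at this
    · exact ⟨k, hk, _, hRi, hct⟩
  have : Nonempty (Tm L K) := ⟨cst (Sum.inr 0)⟩
  choose! φ hφW τ hτ hτ' using hex
  -- If two auxiliary constants go to the same class of `Γ`, the matching makes them equal in `β`,
  -- hence identical.
  have hinj : {n | Sum.inr n ∈ consts β}.InjOn φ := by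
    intro n hn m hm hnm
    have h₁ := hτ' n hn
    rw [hnm] at h₁
    have := eq_of_deq_inr shape (hR.eq (hτ n hn) (hτ m hm) (h₁.symm.trans (hτ' m hm)))
    simpa using this.symm
  obtain ⟨π, hπ⟩ := exists_perm_eqOn ((finite_consts hβ).preimage Sum.inr_injective.injOn) hinj
  have hRσ : ∀ {t : Tm L K} {c : Const K}, c ∈ inV V ∨ c ∈ consts β → R t (cst c) →
      DEq Γ t (σ (Sum.map id π c)) ∧ Sum.map id π c ∈ inVW V W := by
    have hV : ∀ {t : Tm L K} {c : Const K}, c ∈ inV V → R t (cst c) →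
        DEq Γ t (σ (Sum.map id π c)) ∧ Sum.map id π c ∈ inVW V W := by
      rintro t _ ⟨a, ha, rfl⟩ ht
      refine ⟨?_, .inl ⟨a, ha, rfl⟩⟩
      simpa only [Sum.map_inl, id, hσ.inl] using hR'.eq ht (hR'.refl a ha) (.refl _)
    rintro t c (hc | hc) ht
    · exact hV hc ht
    · rcases c with a | n
      · exact hV ⟨a, mem_of_inl_mem_consts shape hc, rfl⟩ ht
      · refine ⟨?_, .inr ⟨φ n, hφW n hc, by simp [hπ n hc]⟩⟩
        simp only [Sum.map_inr, hπ n hc]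
        exact (hR'.eq ht (hτ n hc) (.refl _)).trans (hτ' n hc).symm
  have lift : ∀ {l}, Derives β l →
      Derives (Lit.subst (auxRename π) '' β) (l.subst (auxRename π)) := by
    intro l hl
    exact hl.subst fun l hl => .hyp (Set.mem_image_of_mem _ hl)
  -- The basis is built around the renamed `β`, which uses the names of `σ`; the inverse permutation
  -- recovers `β`.
  refine ⟨π.symm, W, Lit.subst (auxRename π) '' β, _, hσ.isBasis hΓ hV (hβ.image _) ?_ ?_ ?_, ?_⟩
  · rintro _ ⟨l, hl, rfl⟩
    refine (shape l hl).subst π fun n hn => ?_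
    have hn' : Sum.inr n ∈ consts β := ⟨l, hl, hn⟩
    rw [hπ n hn']
    exact hφW n hn'
  · rintro _ ⟨l, hl, rfl⟩
    have hs := shape l hl
    cases hs with
    | eq ha hb =>
      obtain ⟨a, ha, rfl⟩ := ha
      obtain ⟨b, hb, rfl⟩ := hb
      simp only [Lit.subst, Term.subst, auxRename, Sum.map_inl, id, hσ.inl]
      exact hR'.deq ha hb (.hyp hl)
    | ne ha hb =>
      obtain ⟨a, ha, rfl⟩ := ha
      obtain ⟨b, hb, rfl⟩ := hb
      simp only [Lit.subst, Term.subst, auxRename, Sum.map_inl, id, hσ.inl]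
      exact hR'.ne a ha b hb (.hyp hl)
    | fn f bs ha hbs hj =>
      obtain ⟨a, ha, rfl⟩ := ha
      obtain ⟨j, b, hb, hj⟩ := hj
      obtain ⟨ts, hts, -, hf⟩ := hR'.fn a ha f _ (right_mem_terms hl) (.hyp hl)
        ⟨j, b, hb, by rw [hj]; exact .refl _⟩
      simp only [Lit.subst, Term.subst, auxRename, Sum.map_inl, id, hσ.inl]
      refine hf.trans (.cong f _ _ fun i => ?_)
      exact (hRσ (.inr (arg_mem_terms (right_mem_terms hl) i)) (hts i)).1
  · intro l hs hl
    cases hs with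
    | eq ha hb =>
      obtain ⟨a, ha, rfl⟩ := ha
      obtain ⟨b, hb, rfl⟩ := hb
      simp only [Lit.subst, Term.subst, hσ.inl] at hl
      exact lift (hR.deq ha hb hl)
    | ne ha hb =>
      obtain ⟨a, ha, rfl⟩ := ha
      obtain ⟨b, hb, rfl⟩ := hb
      simp only [Lit.subst, Term.subst, hσ.inl] at hl
      exact lift (hR.ne a ha b hb hl)
    | fn f bs ha hbs hj =>
      obtain ⟨a, ha, rfl⟩ := ha
      obtain ⟨j, b, hb, hj⟩ := hj
      simp only [Lit.subst, Term.subst, hσ.inl] at hl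
      obtain ⟨ss, ss', h₁, h₂, -, h₃, h₄⟩ := hR.exists_fn ha hl
        ⟨j, b, hb, by rw [← hj, hσ.inl]; exact .refl _⟩
      obtain ⟨-, -, cs, rfl, -, -, -⟩ := exists_of_func_mem_terms_beta shape h₃
      refine Derives.trans (lift h₄) (.cong f _ _ fun i => ?_)
      obtain ⟨h₅, h₆⟩ := hRσ (.inr (arg_mem_terms h₃ i)) (h₂ i)
      have h₇ := h₅.symm.trans (h₁ i)
      -- The matched argument and `bs i` name the same class of `Γ`: they are the same constant, or
      -- both lie in `V` and `β` proves them equal.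
      rcases hσ.eq_or_mem h₆ (hbs i) h₇ with h₈ | ⟨⟨b, hb, hb'⟩, ⟨c, hc, hc'⟩⟩
      · rw [← h₈]
        exact .refl _
      · rw [← hb', ← hc', hσ.inl, hσ.inl] at h₇
        simp only [Term.subst, auxRename]
        rw [← hb', ← hc']
        exact lift (hR.deq hb hc h₇)
  · rw [rename_image_eq, Set.image_image]
    simp [Lit.subst_auxRename_symm]

theorem isBase_iff (hΓ : Γ.Finite) (hV : V.Finite) :
    IsBase Γ V β ↔ β.Finite ∧ (∀ l ∈ β, BetaShape V Set.univ l) ∧ InterfaceEquiv V Γ β :=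
  ⟨fun h => ⟨h.finite, h.shape, h.interfaceEquiv⟩, fun h => h.2.2.isBase hΓ hV h.1 h.2.1⟩

theorem InterfaceEquiv.isBase_iff {Γ' : Lits L K} (h : InterfaceEquiv V Γ Γ') (hΓ : Γ.Finite)
    (hΓ' : Γ'.Finite) (hV : V.Finite) : IsBase Γ V β ↔ IsBase Γ' V β := by
  rw [UP.isBase_iff hΓ hV, UP.isBase_iff hΓ' hV]
  exact and_congr_right fun _ => and_congr_right fun _ => ⟨h.symm.trans, h.trans⟩

/-- An element is chosen from the set of all bases. Sets of literals that share a base match each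
other, hence have the same set of bases and the same choice. -/
theorem exists_isBaseAbstraction :
    ∃ α : Set K → Lits L K → Lits L K, IsBaseAbstraction α := by
  classical
  refine ⟨fun V Γ => if h : {β | IsBase Γ V β}.Nonempty then h.some else ∅, ?_, ?_⟩
  · intro V hV Γ hΓ _
    have h : {β | IsBase Γ V β}.Nonempty := exists_isBase hΓ hV
    rw [dif_pos h]
    exact h.some_mem
  · rintro V hV Γ Γ' hΓ _ hΓ' _ ⟨β, h, h'⟩
    have : {β | IsBase Γ V β} = {β | IsBase Γ' V β} := by
      ext β'
      exact (h.interfaceEquiv.trans h'.interfaceEquiv.symm).isBase_iff hΓ hΓ' hV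
    simp only [this]

theorem IsBaseAbstraction.eq_of_interfaceEquiv {α : Set K → Lits L K → Lits L K}
    (hα : IsBaseAbstraction α) {Γ' : Lits L K} (hV : V.Finite) (hΓ : Γ.Finite)
    (hs : Satisfiable Γ) (hΓ' : Γ'.Finite) (hs' : Satisfiable Γ') (h : InterfaceEquiv V Γ Γ') :
    α V Γ = α V Γ' := by
  obtain ⟨β, hβ⟩ := exists_isBase hΓ hV
  exact hα.canonical V hV Γ Γ' hΓ hs hΓ' hs' ⟨β, hβ, (h.isBase_iff hΓ hΓ' hV).1 hβ⟩

end UP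

namespace UP

open FirstOrder.Language (Term)

variable {L : FirstOrder.Language.{u, v}} {K : Type w} {V : Set K} {W : Set ℕ}
  {Γ Γ' β δ : Lits L K}

/-! ## Adding a disequation -/

theorem func_mem_terms_union_ne {c d : Const K} {n : ℕ} {f : L.Functions n}
    {ts : Fin n → Tm L K} (h : Term.func f ts ∈ terms (Γ ∪ {.ne (cst c) (cst d)})) :
    Term.func f ts ∈ terms Γ := by
  rw [terms_union] at h
  refine h.resolve_right ?_
  rintro ⟨l, rfl, ht | ht⟩ <;> simp at ht

theorem func_mem_terms_union_eq {c d : Const K} {n : ℕ} {f : L.Functions n}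
    {ts : Fin n → Tm L K} (h : Term.func f ts ∈ terms (Γ ∪ {.eq (cst c) (cst d)})) :
    Term.func f ts ∈ terms Γ := by
  rw [terms_union] at h
  refine h.resolve_right ?_
  rintro ⟨l, rfl, ht | ht⟩ <;> simp at ht

theorem deq_union_ne {t s t' s' : Tm L K} (h : DEq (Γ ∪ {.ne t' s'}) t s) : DEq Γ t s :=
  h.cut fun _ _ h => .hyp (h.resolve_right (by simp))

/-- A disequation adds no equality, so the same relation works. A derived disequation goes back
either to an old one or to the new one, with sides replaced by equals. -/
theorem InterfaceSim.union_ne {R : Tm L K → Tm L K → Prop} (h : InterfaceSim V Γ Γ' R) {a b : K}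
    (ha : a ∈ V) (hb : b ∈ V) :
    InterfaceSim V (Γ ∪ {.ne (cst (Sum.inl a)) (cst (Sum.inl b))})
      (Γ' ∪ {.ne (cst (Sum.inl a)) (cst (Sum.inl b))}) R := by
  have mono : ∀ {l}, Derives Γ' l →
      Derives (Γ' ∪ {.ne (cst (Sum.inl a)) (cst (Sum.inl b))}) l :=
    Derives.mono Set.subset_union_left
  refine ⟨h.refl, fun ht hs hts => mono (h.eq ht hs (deq_union_ne hts)), ?_, ?_⟩
  · intro c hc d hd hcd
    obtain ⟨t, s, hts | hts, h'⟩ := hcd.exists_of_ne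
    · exact mono (h.ne c hc d hd (Derives.of_exists_ne (.hyp hts)
        (h'.imp (And.imp deq_union_ne deq_union_ne) (And.imp deq_union_ne deq_union_ne))))
    · simp only [Set.mem_singleton_iff, Lit.ne.injEq] at hts
      obtain ⟨rfl, rfl⟩ := hts
      refine Derives.of_exists_ne (.hyp (.inr rfl)) ?_
      exact h'.imp
        (And.imp (fun h' => mono (h.deq ha hc (deq_union_ne h')))
          (fun h' => mono (h.deq hb hd (deq_union_ne h'))))
        (And.imp (fun h' => mono (h.deq ha hd (deq_union_ne h')))
          (fun h' => mono (h.deq hb hc (deq_union_ne h'))))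
  · rintro c hc n f ts hts hf ⟨j, b, hb, hj⟩
    obtain ⟨ts', hR, hts', hf'⟩ := h.fn c hc f ts (func_mem_terms_union_ne hts) (deq_union_ne hf)
      ⟨j, b, hb, deq_union_ne hj⟩
    exact ⟨ts', hR, terms_mono Set.subset_union_left hts', mono hf'⟩

theorem InterfaceEquiv.union_ne (h : InterfaceEquiv V Γ Γ') {a b : K} (ha : a ∈ V) (hb : b ∈ V) :
    InterfaceEquiv V (Γ ∪ {.ne (cst (Sum.inl a)) (cst (Sum.inl b))})
      (Γ' ∪ {.ne (cst (Sum.inl a)) (cst (Sum.inl b))}) := by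
  obtain ⟨R, h, h'⟩ := h
  exact ⟨R, h.union_ne ha hb, h'.union_ne ha hb⟩

/-! ## Adding a definition of a fresh constant -/

open Classical in
/-- The substitution of `t` for the constant `k`. -/
noncomputable def replace (k : K) (t : Tm L K) (c : Const K) : Tm L K :=
  if c = Sum.inl k then t else cst c

theorem replace_self (k : K) (t : Tm L K) : replace k t (Sum.inl k) = t := if_pos rfl

theorem replace_of_ne {k : K} {t : Tm L K} {c : Const K} (h : c ≠ Sum.inl k) :
    replace k t c = cst c := if_neg h

theorem subst_replace {k : K} {t s : Tm L K} (h : ¬ Subterm (cst (Sum.inl k)) s) :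
    s.subst (replace k t) = s :=
  subst_eq_self fun _ hc => replace_of_ne fun hck => h (hck ▸ hc)

theorem subst_replace_of_mem {k : K} {t s : Tm L K} (hk : Sum.inl k ∉ consts Γ)
    (hs : s ∈ terms Γ) : s.subst (replace k t) = s :=
  subst_replace fun h => hk (h.mem_terms hs)

/-- A definition of a fresh constant is conservative: substituting its definition for it makes the
added equation trivial. -/
theorem derives_union_def_iff {k : K} {t : Tm L K} (hk : Sum.inl k ∉ consts Γ)
    (ht : ¬ Subterm (cst (Sum.inl k)) t) (l : Lit L K) :
    Derives (Γ ∪ {.eq (cst (Sum.inl k)) t}) l ↔ Derives Γ (l.subst (replace k t)) := by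
  have hl : ∀ l ∈ Γ, l.subst (replace k t) = l := fun l hl =>
    Lit.subst_eq_self fun c hc => replace_of_ne fun hck => hk ⟨l, hl, hck ▸ hc⟩
  constructor
  · intro h
    refine h.subst ?_
    rintro l (hlΓ | rfl)
    · rw [hl l hlΓ]
      exact .hyp hlΓ
    · simp only [Lit.subst, Term.subst, replace_self, subst_replace ht]
      exact .refl _
  · intro h
    refine (Derives.subst_iff (fun d => ?_) l).1 (h.mono Set.subset_union_left)
    by_cases hd : d = Sum.inl k
    · rw [hd, replace_self]
      exact .hyp (.inr rfl)
    · rw [replace_of_ne hd]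
      exact .refl _

/-- Substituting `b` for `k` reduces every question about the extended sets to the old ones, where
`b` is already in `V`. -/
theorem InterfaceSim.union_copy {R : Tm L K → Tm L K → Prop} (h : InterfaceSim V Γ Γ' R)
    {k b : K} (hb : b ∈ V) (hkV : k ∉ V) (hk : Sum.inl k ∉ consts Γ)
    (hk' : Sum.inl k ∉ consts Γ') :
    InterfaceSim (insert k V) (Γ ∪ {.eq (cst (Sum.inl k)) (cst (Sum.inl b))})
      (Γ' ∪ {.eq (cst (Sum.inl k)) (cst (Sum.inl b))})
      (fun t s => R (t.subst (replace k (cst (Sum.inl b))))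
        (s.subst (replace k (cst (Sum.inl b))))) := by
  have hkb : ¬ Subterm (cst (Sum.inl k)) (cst (L := L) (Sum.inl b)) := by
    rw [subterm_var]
    intro h
    obtain rfl : k = b := by simpa using h
    exact hkV hb
  have iff := fun l => derives_union_def_iff (l := l) hk hkb
  have iff' := fun l => derives_union_def_iff (l := l) hk' hkb
  have hV : ∀ a ∈ insert k V, ∃ a' ∈ V,
      replace k (cst (L := L) (Sum.inl b)) (Sum.inl a) = cst (Sum.inl a') := by
    rintro a (rfl | ha)
    · exact ⟨b, hb, replace_self _ _⟩
    · refine ⟨a, ha, replace_of_ne ?_⟩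
      rintro ⟨⟩
      exact hkV ha
  refine ⟨?_, ?_, ?_, ?_⟩
  · intro a ha
    obtain ⟨a', ha', h'⟩ := hV a ha
    simpa only [Term.subst, h'] using h.refl a' ha'
  · intro t t' s s' ht hs hts
    exact (iff' _).2 (h.eq ht hs ((iff _).1 hts))
  · intro a ha c hc hac
    obtain ⟨a', ha', h₁⟩ := hV a ha
    obtain ⟨c', hc', h₂⟩ := hV c hc
    rw [iff] at hac
    rw [iff']
    simp only [Lit.subst, Term.subst, h₁, h₂] at hac ⊢
    exact h.ne a' ha' c' hc' hac
  · rintro a ha n f ts hts hf ⟨j, c, hc, hj⟩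
    obtain ⟨a', ha', h₁⟩ := hV a ha
    obtain ⟨c', hc', h₂⟩ := hV c hc
    have hts := func_mem_terms_union_eq hts
    have hf := (iff _).1 hf
    have hj := (iff _).1 hj
    simp only [Lit.subst, h₁, subst_replace_of_mem hk hts, Term.subst.eq_1] at hf
    simp only [Lit.subst, h₂, subst_replace_of_mem hk (arg_mem_terms hts j),
      Term.subst.eq_1] at hj
    obtain ⟨ts', hR, hts', hf'⟩ := h.fn a' ha' f ts hts hf ⟨j, c', hc', hj⟩
    refine ⟨ts', fun i => ?_, terms_mono Set.subset_union_left hts', (iff' _).2 ?_⟩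
    · rw [subst_replace_of_mem hk (arg_mem_terms hts i),
        subst_replace_of_mem hk' (arg_mem_terms hts' i)]
      exact hR i
    · simpa only [Lit.subst, h₁, subst_replace_of_mem hk' hts', Term.subst.eq_1] using hf'

theorem InterfaceEquiv.union_copy (h : InterfaceEquiv V Γ Γ') {k b : K} (hb : b ∈ V)
    (hkV : k ∉ V) (hk : Sum.inl k ∉ consts Γ) (hk' : Sum.inl k ∉ consts Γ') :
    InterfaceEquiv (insert k V) (Γ ∪ {.eq (cst (Sum.inl k)) (cst (Sum.inl b))})
      (Γ' ∪ {.eq (cst (Sum.inl k)) (cst (Sum.inl b))}) := by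
  obtain ⟨R, h, h'⟩ := h
  exact ⟨_, h.union_copy hb hkV hk hk', h'.union_copy hb hkV hk' hk⟩

theorem not_deq_cst_of_not_deq {T : Tm L K} {n : ℕ} {f : L.Functions n} {ts : Fin n → Tm L K}
    (hT : T = Term.func f ts) (h : ∀ t ∈ terms Γ, ¬ DEq Γ t T) (c : Const K) :
    ¬ DEq Γ (cst c) T := by
  subst hT
  intro hc
  obtain ⟨ss, hss, hs⟩ := hc.exists_func_of_cst
  exact h _ hss (.cong f _ _ hs)

/-- The class of `T` contains no occurring term, so `k` names a new class that interacts with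
nothing else. The relation gains only the pair of `k` with itself, and the only new application to
match is `T`, whose arguments are in `V`. -/
theorem InterfaceSim.union_new {R : Tm L K → Tm L K → Prop} (h : InterfaceSim V Γ Γ' R)
    {k : K} {n : ℕ} {f : L.Functions n} {bs : Fin n → K} (hbs : ∀ i, bs i ∈ V) (hkV : k ∉ V)
    (hk : Sum.inl k ∉ consts Γ) (hR : ∀ t s, R t s → ¬ Subterm (cst (Sum.inl k)) t ∧
      ¬ DEq Γ t (appc f fun i => Sum.inl (bs i)))
    (hΓ : ∀ t ∈ terms Γ, ¬ DEq Γ t (appc f fun i => Sum.inl (bs i))) :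
    InterfaceSim (insert k V) (Γ ∪ {.eq (cst (Sum.inl k)) (appc f fun i => Sum.inl (bs i))})
      (Γ' ∪ {.eq (cst (Sum.inl k)) (appc f fun i => Sum.inl (bs i))})
      (fun t s => R t s ∨ (t = cst (Sum.inl k) ∧ s = cst (Sum.inl k))) := by
  set T : Tm L K := appc f fun i => Sum.inl (bs i) with hT
  have hkT : ¬ Subterm (cst (Sum.inl k)) T := by
    rw [hT, subterm_cst_func]
    rintro ⟨i, hi⟩
    obtain rfl : k = bs i := by simpa using hi
    exact hkV (hbs i)
  have iff := fun l => derives_union_def_iff (l := l) hk hkT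
  have hcst := not_deq_cst_of_not_deq hT hΓ
  have mono : ∀ {l}, Derives Γ' l → Derives (Γ' ∪ {.eq (cst (Sum.inl k)) T}) l :=
    Derives.mono Set.subset_union_left
  have hV : ∀ a ∈ V, ¬ Subterm (cst (Sum.inl k)) (cst (L := L) (Sum.inl a)) := by
    intro a ha hka
    obtain rfl : k = a := by simpa using hka
    exact hkV ha
  have hself : (cst (Sum.inl k) : Tm L K).subst (replace k T) = T := replace_self _ _
  have eq_iff : ∀ {t s : Tm L K}, ¬ Subterm (cst (Sum.inl k)) t → ¬ Subterm (cst (Sum.inl k)) s →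
      DEq (Γ ∪ {.eq (cst (Sum.inl k)) T}) t s → DEq Γ t s := by
    intro t s ht hs h
    have := (iff _).1 h
    rwa [Lit.subst, subst_replace ht, subst_replace hs] at this
  have not_deq : ∀ {t : Tm L K}, ¬ Subterm (cst (Sum.inl k)) t → ¬ DEq Γ t T →
      ¬ DEq (Γ ∪ {.eq (cst (Sum.inl k)) T}) t (cst (Sum.inl k)) := by
    intro t ht htT h
    have := (iff _).1 h
    rw [Lit.subst, subst_replace ht, hself] at this
    exact htT this
  -- Both sides of a derivable disequation are equal to occurring terms, which `T` is not.
  have not_ne : ∀ s : Tm L K, ¬ Derives Γ (.ne T s) := by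
    intro s h
    obtain ⟨t₀, s₀, h₀, ⟨h₁, -⟩ | ⟨-, h₁⟩⟩ := h.exists_of_ne
    · exact hΓ _ ⟨_, h₀, .inl (.refl _)⟩ h₁
    · exact hΓ _ ⟨_, h₀, .inr (.refl _)⟩ h₁
  have hsub : ∀ {t}, t ∈ terms Γ → ¬ Subterm (cst (Sum.inl k)) t := fun ht h =>
    hk (h.mem_terms ht)
  refine ⟨?_, ?_, ?_, ?_⟩
  · rintro a (rfl | ha)
    · exact .inr ⟨rfl, rfl⟩
    · exact .inl (h.refl a ha)
  · rintro t t' s s' (ht | ⟨rfl, rfl⟩) (hs | ⟨rfl, rfl⟩) hts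
    · exact mono (h.eq ht hs (eq_iff (hR _ _ ht).1 (hR _ _ hs).1 hts))
    · exact (not_deq (hR _ _ ht).1 (hR _ _ ht).2 hts).elim
    · exact (not_deq (hR _ _ hs).1 (hR _ _ hs).2 hts.symm).elim
    · exact .refl _
  · rintro a ha b hb hab
    have hab' := (iff _).1 hab
    rcases ha with rfl | ha
    · rw [Lit.subst, hself] at hab'
      exact (not_ne _ hab').elim
    · rcases hb with rfl | hb
      · rw [Lit.subst, hself] at hab'
        exact (not_ne _ hab'.ne_symm).elim
      · rw [Lit.subst, subst_replace (hV a ha), subst_replace (hV b hb)] at hab'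
        exact mono (h.ne a ha b hb hab')
  · rintro a ha m g ts hts hf ⟨j, c, hc, hj⟩
    rw [terms_union] at hts
    rcases hts with hts | ⟨l, rfl, hts | hts⟩
    · rcases ha with rfl | ha
      · exact (not_deq (hsub hts) (hΓ _ hts) hf.symm).elim
      · rcases hc with rfl | hc
        · exact (not_deq (hsub (arg_mem_terms hts j)) (hΓ _ (arg_mem_terms hts j)) hj.symm).elim
        · obtain ⟨ts', hR', hts', hf'⟩ := h.fn a ha g ts hts (eq_iff (hV a ha) (hsub hts) hf)
            ⟨j, c, hc, eq_iff (hV c hc) (hsub (arg_mem_terms hts j)) hj⟩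
          exact ⟨ts', fun i => .inl (hR' i), terms_mono Set.subset_union_left hts', mono hf'⟩
    · simp at hts
    · rw [hT, subterm_func] at hts
      rcases hts with hts | ⟨i, hts⟩
      · cases hts
        rcases ha with rfl | ha
        · refine ⟨_, fun i => .inl (h.refl _ (hbs i)), ?_, .hyp (.inr rfl)⟩
          rw [terms_union]
          exact .inr ⟨_, rfl, .inr (.refl _)⟩
        · exact (hcst _ (eq_iff (hV a ha) hkT hf)).elim
      · simp at hts

theorem InterfaceEquiv.union_new (h : InterfaceEquiv V Γ Γ') {k : K} {n : ℕ} {f : L.Functions n}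
    {bs : Fin n → K} (hbs : ∀ i, bs i ∈ V) (hkV : k ∉ V) (hk : Sum.inl k ∉ consts Γ)
    (hk' : Sum.inl k ∉ consts Γ')
    (hΓ : ∀ t ∈ terms Γ, ¬ DEq Γ t (appc f fun i => Sum.inl (bs i)))
    (hΓ' : ∀ t ∈ terms Γ', ¬ DEq Γ' t (appc f fun i => Sum.inl (bs i))) :
    InterfaceEquiv (insert k V)
      (Γ ∪ {.eq (cst (Sum.inl k)) (appc f fun i => Sum.inl (bs i))})
      (Γ' ∪ {.eq (cst (Sum.inl k)) (appc f fun i => Sum.inl (bs i))}) := by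
  obtain ⟨R, h, h'⟩ := h
  -- The matching is cut down to occurring terms and constants of `V`, none of which contains `k` or
  -- equals `f(b⃗)`.
  let A : Lits L K → Set (Tm L K) := fun Γ => {t | t ∈ terms Γ ∨ ∃ a ∈ V, t = cst (Sum.inl a)}
  have hA : ∀ Γ : Lits L K, Sum.inl k ∉ consts Γ →
      (∀ t ∈ terms Γ, ¬ DEq Γ t (appc f fun i => Sum.inl (bs i))) → ∀ t ∈ A Γ,
      ¬ Subterm (cst (Sum.inl k)) t ∧ ¬ DEq Γ t (appc f fun i => Sum.inl (bs i)) := by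
    rintro Γ hk hΓ t (ht | ⟨a, ha, rfl⟩)
    · exact ⟨fun h => hk (h.mem_terms ht), hΓ t ht⟩
    · refine ⟨fun hka => ?_, not_deq_cst_of_not_deq rfl hΓ _⟩
      obtain rfl : k = a := by simpa using hka
      exact hkV ha
  have hr := h.restrict (A := A Γ) (B := A Γ') (fun _ => .inl) (fun _ => .inl)
    (fun a ha => .inr ⟨a, ha, rfl⟩) (fun a ha => .inr ⟨a, ha, rfl⟩)
  have hr' := (h'.restrict (A := A Γ') (B := A Γ) (fun _ => .inl) (fun _ => .inl)
    (fun a ha => .inr ⟨a, ha, rfl⟩) (fun a ha => .inr ⟨a, ha, rfl⟩))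
  refine ⟨_, hr.union_new hbs hkV hk (fun t s hts => hA Γ hk hΓ t hts.2.1) hΓ, ?_⟩
  refine (hr'.union_new hbs hkV hk' (fun t s hts => hA Γ' hk' hΓ' t hts.2.1) hΓ').congr ?_
  intro t s
  simp only [and_comm]

/-- The matching extends to the constant that an assignment of `f(b⃗)` defines, if the value has
been computed before only when it is still named by a constant in `V`. -/
theorem InterfaceEquiv.union_fn [IsEmpty (L.Functions 0)] (h : InterfaceEquiv V Γ β)
    (shape : ∀ l ∈ β, BetaShape V W l) {k : K} {n : ℕ} {f : L.Functions n} {bs : Fin n → K}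
    (hbs : ∀ i, bs i ∈ V) (hkV : k ∉ V) (hk : Sum.inl k ∉ consts Γ)
    (memo : ∀ t ∈ terms Γ, DEq Γ t (appc f fun i => Sum.inl (bs i)) →
      ∃ a ∈ V, DEq Γ (cst (Sum.inl a)) t) :
    InterfaceEquiv (insert k V)
      (Γ ∪ {.eq (cst (Sum.inl k)) (appc f fun i => Sum.inl (bs i))})
      (β ∪ {.eq (cst (Sum.inl k)) (appc f fun i => Sum.inl (bs i))}) := by
  have hk' : Sum.inl k ∉ consts β := fun h => hkV (mem_of_inl_mem_consts shape h)
  by_cases hex : ∃ a ∈ V, DEq Γ (cst (Sum.inl a)) (appc f fun i => Sum.inl (bs i))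
  · obtain ⟨a, ha, haf⟩ := hex
    have haf' : DEq β (cst (Sum.inl a)) (appc f fun i => Sum.inl (bs i)) := by
      obtain ⟨R, h, -⟩ := h
      exact h.deq_fn ha hbs haf
    have key : ∀ {Γ : Lits L K} {t s r : Tm L K}, DEq Γ s r → ∀ l,
        Derives (Γ ∪ {.eq t s}) l ↔ Derives (Γ ∪ {.eq t r}) l := by
      have : ∀ {Γ : Lits L K} {t s r : Tm L K}, DEq Γ s r → ∀ l,
          Derives (Γ ∪ {.eq t s}) l → Derives (Γ ∪ {.eq t r}) l := by
        intro Γ t s r h l hl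
        refine hl.cut ?_
        rintro l (hl | rfl)
        · exact .hyp (.inl hl)
        · exact Derives.trans (.hyp (.inr rfl)) (h.symm.mono Set.subset_union_left)
      intro Γ t s r h l
      exact ⟨this h l, this h.symm l⟩
    exact (InterfaceEquiv.of_derives_iff (key haf.symm)).trans
      ((h.union_copy ha hkV hk hk').trans (.of_derives_iff (key haf')))
  · have hV : ∀ a ∈ V, ¬ DEq β (cst (Sum.inl a)) (appc f fun i => Sum.inl (bs i)) := by
      intro a ha haf
      obtain ⟨R, -, h'⟩ := h
      exact hex ⟨a, ha, h'.deq_fn ha hbs haf⟩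
    refine h.union_new hbs hkV hk hk' ?_ ?_
    · intro t ht htf
      obtain ⟨a, ha, hat⟩ := memo t ht htf
      exact hex ⟨a, ha, hat.trans htf⟩
    -- An occurring term of `β` is a constant of `V`, an auxiliary constant equal only to itself, or
    -- an application equal to a constant of `V`.
    · intro t ht htf
      cases t with
      | var c =>
        rcases c with a | m
        · exact hV a (mem_of_inl_mem_consts shape ht) htf
        · have := eq_of_deq_inr shape htf
          cases this
      | func g ts =>
        obtain ⟨a, ha, bs', rfl, -, -, hl⟩ := exists_of_func_mem_terms_beta shape ht
        exact hV a ha (Derives.trans (.hyp hl) htf)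

/-! ## Adding an equation between constants in `V` -/

/-- Adding `t₀ ≈ s₀` only affects superterms of `t₀` and `s₀`. -/
theorem DEq.of_union_eq {t₀ s₀ t s : Tm L K} (h : DEq (Γ ∪ {.eq t₀ s₀}) t s) :
    DEq Γ t s ∨ (∃ r, (Subterm t₀ r ∨ Subterm s₀ r) ∧ DEq Γ t r) ∧
      ∃ r, (Subterm t₀ r ∨ Subterm s₀ r) ∧ DEq Γ s r := by
  refine h.rec_eq (p := fun t s => DEq Γ t s ∨
    (∃ r, (Subterm t₀ r ∨ Subterm s₀ r) ∧ DEq Γ t r) ∧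
      ∃ r, (Subterm t₀ r ∨ Subterm s₀ r) ∧ DEq Γ s r) ?_ ?_ ?_ ?_ ?_
  · rintro t s (h | h)
    · exact .inl (.hyp h)
    · simp only [Set.mem_singleton_iff, Lit.eq.injEq] at h
      obtain ⟨rfl, rfl⟩ := h
      exact .inr ⟨⟨_, .inl (.refl _), .refl _⟩, ⟨_, .inr (.refl _), .refl _⟩⟩
  · exact fun t => .inl (.refl t)
  · rintro t s - h
    exact h.imp .symm And.symm
  · rintro t s r - - (h₁ | ⟨h₁, h₂⟩) (h₃ | ⟨h₃, h₄⟩)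
    · exact .inl (h₁.trans h₃)
    · obtain ⟨r', hr', h'⟩ := h₃
      exact .inr ⟨⟨r', hr', h₁.trans h'⟩, h₄⟩
    · obtain ⟨r', hr', h'⟩ := h₂
      exact .inr ⟨h₁, ⟨r', hr', h₃.symm.trans h'⟩⟩
    · exact .inr ⟨h₁, h₄⟩
  · intro n f ts ss _ ih
    by_cases hall : ∀ i, DEq Γ (ts i) (ss i)
    · exact .inl (.cong f _ _ hall)
    · push Not at hall
      obtain ⟨i, hi⟩ := hall
      -- If one argument equals a superterm `r`, putting `r` in its place gives a superterm equal to
      -- the whole application.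
      have key : ∀ us : Fin n → Tm L K,
          (∃ r, (Subterm t₀ r ∨ Subterm s₀ r) ∧ DEq Γ (us i) r) →
          ∃ r, (Subterm t₀ r ∨ Subterm s₀ r) ∧ DEq Γ (Term.func f us) r := by
        rintro us ⟨r, hr, hur⟩
        have hself : Function.update us i r i = r := Function.update_self ..
        refine ⟨Term.func f (Function.update us i r), ?_, .cong f _ _ fun j => ?_⟩
        · exact hr.imp (fun h => .arg f _ i (hself.symm ▸ h)) (fun h => .arg f _ i (hself.symm ▸ h))
        · by_cases hj : j = i
          · subst hj
            rwa [hself]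
          · rw [Function.update_of_ne hj]
            exact .refl _
      exact .inr ⟨key ts ((ih i).resolve_left hi).1, key ss ((ih i).resolve_left hi).2⟩

/-- The flat equations form a partial function table, which the hypothesis makes consistent; all
other entries are arbitrary. -/
theorem exists_structure_of_flat {M : Type (max u w)} [Nonempty M] (ρ : Const K → M)
    (h : ∀ (n : ℕ) (f : L.Functions n) c c' bs bs', Lit.eq (cst c) (appc f bs) ∈ Γ →
      Lit.eq (cst c') (appc f bs') ∈ Γ → (∀ i, ρ (bs i) = ρ (bs' i)) → ρ c = ρ c') :
    ∃ _ : L.Structure M, ∀ (n : ℕ) (f : L.Functions n) c bs, Lit.eq (cst c) (appc f bs) ∈ Γ →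
      (Lit.eq (cst c) (appc f bs)).Holds ρ := by
  classical
  let S : L.Structure M :=
    { funMap := fun {n} f X =>
        if h : ∃ c bs, Lit.eq (cst c) (appc f bs) ∈ Γ ∧ ∀ i, X i = ρ (bs i) then ρ h.choose
        else Classical.arbitrary M
      RelMap := fun _ _ => False }
  refine ⟨S, fun n f c bs hl => ?_⟩
  have hex : ∃ c' bs', Lit.eq (cst c') (appc f bs') ∈ Γ ∧ ∀ i, ρ (bs i) = ρ (bs' i) :=
    ⟨c, bs, hl, fun _ => rfl⟩
  obtain ⟨bs', hl', hbs'⟩ := hex.choose_spec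
  have : (appc f bs).realize ρ = ρ hex.choose := dif_pos hex
  change ρ c = _
  rw [this]
  exact h n f _ _ _ _ hl hl' hbs'

theorem satisfiable_union_of_isBasis (h : IsBasis Γ V W β δ) (hs : Satisfiable Γ) :
    Satisfiable (β ∪ δ) := by
  obtain ⟨M, _, ν, hν⟩ := hs
  obtain ⟨ν', -, hν'⟩ := (h.equiv M ν).2 hν
  exact ⟨M, _, ν', hν'⟩

namespace IsBasis

theorem shape_fn (h : IsBasis Γ V W β δ) {c : Const K} {n : ℕ} {f : L.Functions n}
    {bs : Fin n → Const K} (hl : Lit.eq (cst c) (appc f bs) ∈ β ∪ δ) :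
    c ∈ inVW V W ∧ (∀ i, bs i ∈ inVW V W) ∧
      (Lit.eq (cst c) (appc f bs) ∈ β ∨ (c ∈ inV V → ∀ i, bs i ∈ inW W)) := by
  rcases hl with hl | hl
  · obtain ⟨hc, hbs⟩ := (h.shape_β _ hl).fn_inv
    exact ⟨.inl hc, hbs, .inl hl⟩
  · obtain ⟨hc, hbs, hW⟩ := (h.shape_δ _ hl).fn_inv
    exact ⟨hc, hbs, .inr hW⟩

variable {a b : K}

/-- If superterms of `a` and `b` in `Γ` are named by constants in `V`, then the equation `a ≈ b`
does not interact with `δ`. -/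
theorem exists_model_union_eq (h : IsBasis Γ V W β δ) (hs : Satisfiable Γ) (ha : a ∈ V)
    (hb : b ∈ V)
    (early : ∀ t ∈ terms Γ, ∀ r, (Subterm (cst (Sum.inl a)) r ∨ Subterm (cst (Sum.inl b)) r) →
      DEq Γ t r → ∃ c ∈ V, DEq Γ (cst (Sum.inl c)) t)
    (hs' : Satisfiable (β ∪ {.eq (cst (Sum.inl a)) (cst (Sum.inl b))})) :
    ∃ (M : Type (max u w)) (_ : L.Structure M) (ρ : Const K → M),
      (∀ l ∈ β ∪ {.eq (cst (Sum.inl a)) (cst (Sum.inl b))} ∪ δ, l.Holds ρ) ∧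
      ∀ c ∈ inVW V W, ∀ d ∈ inVW V W, ρ c = ρ d →
        DEq (β ∪ {.eq (cst (Sum.inl a)) (cst (Sum.inl b))}) (cst c) (cst d) := by
  classical
  set E : Lits L K := {.eq (cst (Sum.inl a)) (cst (Sum.inl b))} with hE
  have shape : ∀ l ∈ β ∪ E, BetaShape V W l := by
    rintro l (hl | rfl)
    · exact h.shape_β l hl
    · exact .eq ⟨a, ha, rfl⟩ ⟨b, hb, rfl⟩
  have mono : ∀ {l}, Derives β l → Derives (β ∪ E) l := Derives.mono Set.subset_union_left
  obtain ⟨σ, hσ, hσ', hd⟩ := h.exists_subst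
  -- An auxiliary constant equal to a superterm of `a` or `b` stands for a term of `Γ` which early
  -- assume puts into a class named by `V`; this contradicts `not_V`.
  have hsuper : ∀ c ∈ inVW V W, ∀ r, (Subterm (cst (Sum.inl a)) r ∨ Subterm (cst (Sum.inl b)) r) →
      DEq (β ∪ δ) (cst c) r → c ∈ inV V := by
    rintro c (hc | ⟨n, hn, rfl⟩) r hr hcr
    · exact hc
    · have hsub : ∀ e : K, Subterm (cst (Sum.inl e)) r →
          Subterm (cst (Sum.inl e)) (r.subst σ) := by
        intro e he
        have := he.subst σ
        rwa [Term.subst, hσ _ inl_notMem_inW] at this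
      obtain ⟨e, he, heσ⟩ := early _ (hσ' n hn) _ (hr.imp (hsub a) (hsub b)) ((hd _).1 hcr)
      refine (h.not_V e he n hn ((hd _).2 ?_)).elim
      simpa only [Lit.subst, Term.subst, hσ _ inl_notMem_inW] using heσ
  let ρ₀ : Const K → Set (Tm L K) := fun c => {t | DEq (β ∪ E) (cst c) t}
  -- Names denote their classes under `β ∪ E`. A constant outside `V ∪ W` takes the value of a name
  -- that `δ` gives it; without one it is unconstrained, and `∅` is a dummy.
  let ρ : Const K → Set (Tm L K) := fun c => if c ∈ inVW V W then ρ₀ c else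
    if hex : ∃ d ∈ inVW V W, Lit.eq (cst d) (cst c) ∈ δ then ρ₀ hex.choose else ∅
  have hρ : ∀ {c}, c ∈ inVW V W → ρ c = ρ₀ c := fun hc => if_pos hc
  have hρρ : ∀ {c}, c ∈ inVW V W → ∀ {d}, d ∈ inVW V W →
      (ρ c = ρ d ↔ DEq (β ∪ E) (cst c) (cst d)) := by
    intro c hc d hd
    rw [hρ hc, hρ hd]
    exact class_eq_class
  have hfn : ∀ (n : ℕ) (f : L.Functions n) c c' bs bs', Lit.eq (cst c) (appc f bs) ∈ β ∪ δ →
      Lit.eq (cst c') (appc f bs') ∈ β ∪ δ → (∀ i, ρ (bs i) = ρ (bs' i)) → ρ c = ρ c' := by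
    intro n f c c' bs bs' hl hl' hbs
    obtain ⟨hc, hbsVW, hlβ⟩ := h.shape_fn hl
    obtain ⟨hc', hbsVW', hlβ'⟩ := h.shape_fn hl'
    simp only [hρρ (hbsVW _) (hbsVW' _)] at hbs
    rw [hρρ hc hc']
    -- If all arguments agree in `β ∪ δ`, so do the values. Otherwise a pair of arguments was merged
    -- by `E`: both are in `V` and equal superterms of `a` or `b`, so both values are in `V` and
    -- both literals belong to `β`, where congruence applies.
    by_cases hall : ∀ i, DEq (β ∪ δ) (cst (bs i)) (cst (bs' i))
    · exact mono (h.deq_beta hc hc' (Derives.trans (.hyp hl)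
        ((Derives.cong f _ _ hall).trans (.symm (.hyp hl')))))
    · push Not at hall
      obtain ⟨i, hi⟩ := hall
      have inV_of : ∀ {c d : Const K}, c ∈ inVW V W → DEq (β ∪ E) (cst c) (cst d) →
          ¬ DEq (β ∪ δ) (cst c) (cst d) → c ∈ inV V := by
        rintro c d (hc | ⟨m, hm, rfl⟩) hcd hcd'
        · exact hc
        · rw [eq_of_deq_inr shape hcd] at hcd'
          exact (hcd' (.refl _)).elim
      have hlit : ∀ {c : Const K} {bs : Fin n → Const K}, c ∈ inVW V W → bs i ∈ inV V →
          (Lit.eq (cst c) (appc f bs) ∈ β ∨ (c ∈ inV V → ∀ i, bs i ∈ inW W)) →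
          Lit.eq (cst c) (appc f bs) ∈ β ∪ δ →
          (∃ r, (Subterm (cst (Sum.inl a)) r ∨ Subterm (cst (Sum.inl b)) r) ∧
            DEq (β ∪ δ) (cst (bs i)) r) → Lit.eq (cst c) (appc f bs) ∈ β := by
        rintro c bs hc hi hβ hl ⟨r, hr, hir⟩
        refine hβ.resolve_right fun hW => disjoint_inV_inW hi (hW ?_ i)
        have hself : Function.update (fun j => (cst (bs j) : Tm L K)) i r i = r :=
          Function.update_self ..
        refine hsuper c hc
          (Term.func f (Function.update (fun j => (cst (bs j) : Tm L K)) i r)) ?_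
          (Derives.trans (.hyp hl) (.cong f _ _ fun j => ?_))
        · exact hr.imp (fun h => .arg f _ i (hself.symm ▸ h)) (fun h => .arg f _ i (hself.symm ▸ h))
        · by_cases hj : j = i
          · subst hj
            rwa [hself]
          · rw [Function.update_of_ne hj]
            exact .refl _
      have hunion : DEq (β ∪ δ ∪ E) (cst (bs i)) (cst (bs' i)) :=
        (hbs i).mono (Set.union_subset_union_left _ Set.subset_union_left)
      obtain ⟨h₁, h₂⟩ := hunion.of_union_eq.resolve_left hi
      have hβ := hlit hc (inV_of (hbsVW i) (hbs i) hi) hlβ hl h₁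
      have hβ' := hlit hc' (inV_of (hbsVW' i) (hbs i).symm fun h => hi h.symm) hlβ' hl' h₂
      exact Derives.trans (.hyp (.inl hβ)) (Derives.trans (.cong f _ _ hbs)
        (.symm (.hyp (.inl hβ'))))
  obtain ⟨S, hS⟩ := exists_structure_of_flat ρ hfn
  refine ⟨_, S, ρ, ?_, fun c hc d hd => (hρρ hc hd).1⟩
  rintro l (hl | hl)
  · have hsl := shape l hl
    cases hsl with
    | eq hc hd => exact (hρρ (.inl hc) (.inl hd)).2 (.hyp hl)
    | ne hc hd =>
      exact fun hcd => satisfiable_iff.1 hs' _ _ hl ((hρρ (.inl hc) (.inl hd)).1 hcd)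
    | fn f bs => exact hS _ f _ bs (.inl (hl.resolve_right (by simp [hE])))
  · have hsl := h.shape_δ l hl
    cases hsl with
    | @eq c d hc hd =>
      have hex : ∃ c ∈ inVW V W, Lit.eq (cst c) (cst d) ∈ δ := ⟨c, hc, hl⟩
      have hd : ρ d = ρ₀ hex.choose := by
        simp only [ρ]
        rw [if_neg hd, dif_pos hex]
      change ρ c = ρ d
      rw [hd, ← hρ hex.choose_spec.1, hρρ hc hex.choose_spec.1]
      -- The choice of name is harmless: two names that `δ` gives to one constant are already equal
      -- in `β`.
      exact mono (h.deq_beta hc hex.choose_spec.1 (Derives.trans (.hyp (.inr hl))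
        (.symm (.hyp (.inr hex.choose_spec.2)))))
    | @ne c d hc hd =>
      intro hcd
      obtain ⟨n, hn, rfl⟩ := hc
      have := eq_of_deq_inr shape ((hρρ (.inr ⟨n, hn, rfl⟩) hd).1 hcd)
      rw [this] at hl
      exact (satisfiable_union_of_isBasis h hs).not_derives_ne _ (.hyp (.inr hl))
    | fn f bs => exact hS _ f _ bs (.inr hl)

theorem satisfiable_union_eq (h : IsBasis Γ V W β δ) (hs : Satisfiable Γ) (ha : a ∈ V)
    (hb : b ∈ V)
    (early : ∀ t ∈ terms Γ, ∀ r, (Subterm (cst (Sum.inl a)) r ∨ Subterm (cst (Sum.inl b)) r) →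
      DEq Γ t r → ∃ c ∈ V, DEq Γ (cst (Sum.inl c)) t)
    (hs' : Satisfiable (β ∪ {.eq (cst (Sum.inl a)) (cst (Sum.inl b))})) :
    Satisfiable (Γ ∪ {.eq (cst (Sum.inl a)) (cst (Sum.inl b))}) := by
  obtain ⟨M, S, ρ, hρ, -⟩ := h.exists_model_union_eq hs ha hb early hs'
  refine ⟨M, S, ρ, ?_⟩
  rintro l (hl | hl)
  · refine (h.equiv M ρ).1 ⟨ρ, fun _ _ => rfl, ?_⟩ l hl
    rintro l (hl | hl)
    · exact hρ l (.inl (.inl hl))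
    · exact hρ l (.inr hl)
  · exact hρ l (.inl (.inr hl))

/-- The model shows that `δ` adds no equality between names to those derivable from `β` with the new
equation. So the auxiliary constants remain distinct and unnamed by `V`, and `W` and `δ` can be
kept. -/
theorem union_eq (h : IsBasis Γ V W β δ) (hs : Satisfiable Γ) (ha : a ∈ V) (hb : b ∈ V)
    (early : ∀ t ∈ terms Γ, ∀ r, (Subterm (cst (Sum.inl a)) r ∨ Subterm (cst (Sum.inl b)) r) →
      DEq Γ t r → ∃ c ∈ V, DEq Γ (cst (Sum.inl c)) t)
    (hs' : Satisfiable (β ∪ {.eq (cst (Sum.inl a)) (cst (Sum.inl b))})) :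
    IsBasis (Γ ∪ {.eq (cst (Sum.inl a)) (cst (Sum.inl b))}) V W
      (β ∪ {.eq (cst (Sum.inl a)) (cst (Sum.inl b))}) δ := by
  obtain ⟨M, _, ρ, hρ, hρ'⟩ := h.exists_model_union_eq hs ha hb early hs'
  set E : Lits L K := {.eq (cst (Sum.inl a)) (cst (Sum.inl b))} with hE
  have shape : ∀ l ∈ β ∪ E, BetaShape V W l := by
    rintro l (hl | rfl)
    · exact h.shape_β l hl
    · exact .eq ⟨a, ha, rfl⟩ ⟨b, hb, rfl⟩
  have hEW : ∀ l ∈ E, ∀ c ∈ l.consts, c ∉ inW W := by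
    rintro _ rfl c (hc | hc)
    · obtain rfl : c = Sum.inl a := by simpa using hc
      exact inl_notMem_inW
    · obtain rfl : c = Sum.inl b := by simpa using hc
      exact inl_notMem_inW
  have hsub : β ∪ δ ⊆ β ∪ E ∪ δ := Set.union_subset_union_left _ Set.subset_union_left
  have deq : ∀ {c d : Const K}, c ∈ inVW V W → d ∈ inVW V W →
      DEq (β ∪ E ∪ δ) (cst c) (cst d) → DEq (β ∪ E) (cst c) (cst d) := fun hc hd hcd =>
    hρ' _ hc _ hd (hcd.entails M ρ hρ)
  have inV_of : ∀ {c d : Const K}, c ∈ inVW V W → d ∈ inV V →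
      DEq (β ∪ E ∪ δ) (cst c) (cst d) → c ∈ inV V := by
    rintro c d (hc | ⟨n, hn, rfl⟩) hd hcd
    · exact hc
    · have := eq_of_deq_inr shape (deq (.inr ⟨n, hn, rfl⟩) (.inl hd) hcd)
      obtain rfl : d = Sum.inr n := by simpa using this
      exact (inr_notMem_inV hd).elim
  obtain ⟨σ, hσ, -, hd⟩ := h.exists_subst
  refine ⟨h.finite_W, h.finite_β.union (Set.finite_singleton _), h.finite_δ, ?_, ?_, ?_, shape,
    h.shape_δ, ?_, ?_, ?_, ?_⟩
  · rintro n hn ⟨l, hl | hl, hnl⟩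
    · exact h.fresh n hn ⟨l, hl, hnl⟩
    · exact hEW l hl _ hnl ⟨n, hn, rfl⟩
  · intro M _ ν
    constructor
    · rintro ⟨ν', hν', hl⟩ l (hlΓ | hlE)
      · exact (h.equiv M ν).1 ⟨ν', hν', fun l hl' => hl l (hsub hl')⟩ l hlΓ
      · exact (hl l (.inl (.inr hlE))).congr fun c hc => hν' c (hEW l hlE c hc)
    · intro hν
      obtain ⟨ν', hν', hl⟩ := (h.equiv M ν).2 fun l hl => hν l (.inl hl)
      refine ⟨ν', hν', ?_⟩
      rintro l ((hlβ | hlE) | hlδ)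
      · exact hl l (.inl hlβ)
      · exact (hν l (.inr hlE)).congr fun c hc => (hν' c (hEW l hlE c hc)).symm
      · exact hl l (.inr hlδ)
  · intro l hl
    constructor
    · intro hl'
      have : Derives (Γ ∪ E) (l.subst σ) := by
        refine hl'.subst ?_
        rintro l ((hlβ | hlE) | hlδ)
        · exact ((hd l).1 (.hyp (.inl hlβ))).mono Set.subset_union_left
        · rw [Lit.subst_eq_self fun c hc => hσ c (hEW l hlE c hc)]
          exact .hyp (.inr hlE)
        · exact ((hd l).1 (.hyp (.inr hlδ))).mono Set.subset_union_left
      rwa [Lit.subst_eq_self fun c hc => hσ c (Set.disjoint_left.1 hl hc)] at this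
    · intro hl'
      refine hl'.cut ?_
      rintro l (hlΓ | hlE)
      · refine ((h.derives_iff l ?_).2 (.hyp hlΓ)).mono hsub
        rw [Set.disjoint_left]
        rintro c hc ⟨n, hn, rfl⟩
        exact h.fresh n hn ⟨l, hlΓ, hc⟩
      · exact .hyp (.inl (.inr hlE))
  · intro e he n hn hen
    exact inr_notMem_inV (inV_of (.inr ⟨n, hn, rfl⟩) ⟨e, he, rfl⟩ hen.symm)
  · intro n hn m hm hnm hl
    have := eq_of_deq_inr shape (deq (.inr ⟨n, hn, rfl⟩) (.inr ⟨m, hm, rfl⟩) hl)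
    exact hnm (by simpa using this.symm)
  · intro n hn
    obtain ⟨t, ht, hnt⟩ := h.names n hn
    exact ⟨t, terms_mono Set.subset_union_left ht, hnt.mono hsub⟩
  · intro l hl hl'
    cases hl with
    | eq hc hd => exact deq (.inl hc) (.inl hd) hl'
    | ne hc hd =>
      obtain ⟨t, s, hts | hts, h'⟩ := hl'.exists_of_ne
      · have hs := shape _ hts
        cases hs with
        | ne hc' hd' =>
          refine Derives.of_exists_ne (.hyp hts) (h'.imp (And.imp ?_ ?_) (And.imp ?_ ?_)) <;>
          exact deq (.inl ‹_›) (.inl ‹_›)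
      · have hs := h.shape_δ _ hts
        cases hs with
        | ne hc' hd' =>
          -- A disequation of `δ` has an auxiliary side, which cannot equal a constant of `V`.
          rcases h' with ⟨h', -⟩ | ⟨h', -⟩
          · exact (disjoint_inV_inW (inV_of (.inr hc') hc h') hc').elim
          · exact (disjoint_inV_inW (inV_of (.inr hc') hd h') hc').elim
    | fn f bs hc hbs hj =>
      obtain ⟨j, hj⟩ := hj
      obtain ⟨ss, hss, hs⟩ := DEq.exists_func_of_cst hl'
      obtain ⟨d, hd, bs', rfl, hbs', hlit⟩ := exists_of_func_mem_terms_union shape h.shape_δ hss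
      have hdc := (Derives.hyp hlit).trans ((Derives.cong f _ _ hs).trans hl'.symm)
      have hdV := inV_of hd hc hdc
      have hlit' : Lit.eq (cst d) (appc f bs') ∈ β ∪ E := by
        refine hlit.resolve_right fun hlδ => ?_
        exact disjoint_inV_inW (inV_of (hbs' j) hj (hs j)) ((h.shape_δ _ hlδ).fn_inv.2.2 hdV j)
      exact (deq hd (.inl hc) hdc).symm.trans (Derives.trans (.hyp hlit')
        (.cong f _ _ fun i => deq (hbs' i) (hbs i) (hs i)))

end IsBasis

end UP

namespace UP

open FirstOrder.Language (Term)

variable {L : FirstOrder.Language.{u, v}} {K : Type w} {Var : Type x} {V : Set K} {W : Set ℕ}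
  {Γ β δ : Lits L K}

/-! ## Satisfiability of extensions -/

theorem Satisfiable.union_def (h : Satisfiable Γ) {k : K} {t : Tm L K} (hk : Sum.inl k ∉ consts Γ)
    (ht : ¬ Subterm (cst (Sum.inl k)) t) : Satisfiable (Γ ∪ {.eq (cst (Sum.inl k)) t}) := by
  rw [satisfiable_iff] at h ⊢
  rintro r s (hrs | hrs) hd
  · refine h r s hrs ?_
    have := (derives_union_def_iff hk ht _).1 hd
    rwa [Lit.subst, subst_replace_of_mem hk ⟨_, hrs, .inl (.refl _)⟩,
      subst_replace_of_mem hk ⟨_, hrs, .inr (.refl _)⟩] at this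
  · simp at hrs

theorem Cond.lit_subst (c : Cond Var) (q : State Var K) (π : ℕ → ℕ) :
    (c.lit q : Lit L K).subst (auxRename π) = c.lit q := by
  cases c <;> rfl

theorem Cond.not_mem_inW (c : Cond Var) (q : State Var K) :
    ∀ e ∈ (c.lit q : Lit L K).consts, e ∉ inW W := by
  intro e he
  cases c with
  | eq a b | ne a b =>
    rcases he with he | he
    · obtain rfl : e = Sum.inl (q a) := by simpa using he
      exact inl_notMem_inW
    · obtain rfl : e = Sum.inl (q b) := by simpa using he
      exact inl_notMem_inW

theorem satisfiable_rename_union_iff (π : Equiv.Perm ℕ) (c : Cond Var) (q : State Var K) :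
    Satisfiable (Lit.rename π '' β ∪ {c.lit q}) ↔ Satisfiable (β ∪ {c.lit q}) := by
  have : Lit.rename π '' β ∪ {c.lit q} = Lit.subst (auxRename π) '' (β ∪ {c.lit q}) := by
    rw [rename_image_eq, Set.image_union, Set.image_singleton, Cond.lit_subst]
  rw [this, Satisfiable.image_subst]

theorem IsBasis.satisfiable_union_cond (h : IsBasis Γ V W β δ) {c : Cond Var} {q : State Var K}
    (hs : Satisfiable (Γ ∪ {c.lit q})) : Satisfiable (β ∪ {c.lit q}) := by
  obtain ⟨M, S, ν, hν⟩ := hs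
  obtain ⟨ν', hν', hl⟩ := (h.equiv M ν).2 fun l hl => hν l (.inl hl)
  refine ⟨M, S, ν', ?_⟩
  rintro l (hlβ | hlc)
  · exact hl l (.inl hlβ)
  · have hlc' := hlc
    simp only [Set.mem_singleton_iff] at hlc'
    exact (hν l (.inr hlc)).congr fun e he => (hν' e (Cond.not_mem_inW c q e (hlc' ▸ he))).symm

theorem IsBase.satisfiable (h : IsBase Γ V β) (hs : Satisfiable Γ) : Satisfiable β := by
  obtain ⟨π, W, β', δ, h, rfl⟩ := h
  rw [rename_image_eq, Satisfiable.image_subst]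
  exact (satisfiable_union_of_isBasis h hs).mono Set.subset_union_left

/-- A condition is consistent with `Γ` if and only if it is consistent with a base of `Γ`. -/
theorem IsBase.satisfiable_union_cond_iff (h : IsBase Γ V β) (hs : Satisfiable Γ)
    {c : Cond Var} {q : State Var K} (hq : ∀ a, q a ∈ V)
    (early : ∀ a b, c = .eq a b → ∀ t ∈ terms Γ, ∀ r, (Subterm (q.val a) r ∨ Subterm (q.val b) r) →
      DEq Γ t r → ∃ e ∈ V, DEq Γ (cst (Sum.inl e)) t) :
    Satisfiable (Γ ∪ {c.lit q}) ↔ Satisfiable (β ∪ {c.lit q}) := by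
  obtain ⟨π, W, β', δ, h, rfl⟩ := h
  rw [satisfiable_rename_union_iff]
  refine ⟨h.satisfiable_union_cond, fun hs' => ?_⟩
  cases c with
  | eq a b => exact h.satisfiable_union_eq hs (hq a) (hq b) (early a b rfl) hs'
  | ne a b =>
    -- A new disequation is inconsistent with `Γ` only if `Γ` equates its sides; the matching
    -- carries that equality to `β`.
    rw [satisfiable_iff]
    rintro t s (hts | hts) hd
    · exact satisfiable_iff.1 hs t s hts (deq_union_ne hd)
    · obtain ⟨rfl, rfl⟩ := Lit.ne.inj hts
      obtain ⟨R, hR, -⟩ := h.interfaceEquiv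
      exact satisfiable_iff.1 hs' _ _ (.inr rfl)
        ((hR.deq (hq a) (hq b) (deq_union_ne hd)).mono Set.subset_union_left)

/-- A base of `Γ` and `Γ` still match after a condition has been added. -/
theorem IsBase.interfaceEquiv_union_cond (h : IsBase Γ V β) (hs : Satisfiable Γ)
    {c : Cond Var} {q : State Var K} (hq : ∀ a, q a ∈ V)
    (early : ∀ a b, c = .eq a b → ∀ t ∈ terms Γ, ∀ r, (Subterm (q.val a) r ∨ Subterm (q.val b) r) →
      DEq Γ t r → ∃ e ∈ V, DEq Γ (cst (Sum.inl e)) t)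
    (hsc : Satisfiable (Γ ∪ {c.lit q})) :
    InterfaceEquiv V (Γ ∪ {c.lit q}) (β ∪ {c.lit q}) := by
  cases c with
  | eq a b =>
    obtain ⟨π, W, β', δ, h, rfl⟩ := h
    have h' := h.union_eq hs (hq a) (hq b) (early a b rfl) (h.satisfiable_union_cond hsc)
    have := h'.interfaceEquiv.trans (.rename π)
    rwa [Set.image_union, ← rename_image_eq, Set.image_singleton] at this
  | ne a b => exact h.interfaceEquiv.union_ne (hq a) (hq b)

/-! ## Steps -/

theorem State.set_self (q : State Var K) (a : Var) (k : K) : q.set a k a = k := by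
  simp [State.set]

theorem State.range_set_subset (q : State Var K) (a : Var) (k : K) :
    Set.range (q.set a k) ⊆ insert k (Set.range q) := by
  rintro _ ⟨b, rfl⟩
  by_cases h : b = a
  · subst h
    exact .inl (q.set_self b k)
  · exact .inr ⟨b, by simp [State.set, h]⟩

variable {N : Naming Var K} {s s' : Stmt L Var} {q q' : State Var K} {pc pc' : Lits L K}

/-- A step is determined by the statement that is executed next. -/
theorem Step.cases_active (h : Step N s q pc s' q' pc') :
    (q' = q ∧ pc' = ∅) ∨
    (∃ c, s.active = .assume c ∧ q' = q ∧ pc' = {c.lit q} ∧ Satisfiable (pc ∪ {c.lit q})) ∨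
    (∃ a b k, s.active = .assign a b ∧ N q a k ∧ Fresh q pc k ∧ q' = q.set a k ∧
      pc' = {.eq (cst (Sum.inl k)) (q.val b)}) ∨
    ∃ a n f, ∃ bs : Fin n → Var, ∃ k, s.active = .assignFn a f bs ∧ N q a k ∧ Fresh q pc k ∧
      q' = q.set a k ∧ pc' = {.eq (cst (Sum.inl k)) (appc f fun i => Sum.inl (q (bs i)))} := by
  induction h with
  | skip_seq => exact .inl ⟨rfl, rfl⟩
  | seq _ _ ih => exact ih
  | assume c q pc hs => exact .inr (.inl ⟨c, rfl, rfl, rfl, hs⟩)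
  | assign a b q pc k hN hk => exact .inr (.inr (.inl ⟨a, b, k, rfl, hN, hk, rfl, rfl⟩))
  | assignFn a f bs q pc k hN hk =>
    exact .inr (.inr (.inr ⟨a, _, f, bs, k, rfl, hN, hk, rfl, rfl⟩))
  | ite_true => exact .inl ⟨rfl, rfl⟩
  | ite_false => exact .inl ⟨rfl, rfl⟩
  | _ => exact .inl ⟨rfl, rfl⟩

/-- A step remains possible when the path condition is replaced, if the condition that it assumes
remains consistent and the constant that it creates remains fresh. -/
theorem Step.transfer (h : Step N s q pc s' q' pc') {pc₁ : Lits L K}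
    (hassume : ∀ c, s.active = .assume c → Satisfiable (pc ∪ {c.lit q}) →
      Satisfiable (pc₁ ∪ {c.lit q}))
    (hfresh : ∀ a k, ((∃ b, s.active = .assign a b) ∨
      ∃ (n : ℕ) (f : L.Functions n) (bs : Fin n → Var), s.active = .assignFn a f bs) →
      q' a = k → N q a k → Fresh q pc k → Fresh q pc₁ k) :
    Step N s q pc₁ s' q' pc' := by
  induction h with
  | skip_seq s q pc => exact .skip_seq s q pc₁
  | seq s₂ _ ih => exact .seq s₂ (ih hassume hfresh)
  | assume c q pc hs => exact .assume c q pc₁ (hassume c rfl hs)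
  | assign a b q pc k hN hk =>
    exact .assign a b q pc₁ k hN (hfresh a k (.inl ⟨b, rfl⟩) (q.set_self a k) hN hk)
  | assignFn a f bs q pc k hN hk =>
    exact .assignFn a f bs q pc₁ k hN
      (hfresh a k (.inr ⟨_, f, bs, rfl⟩) (q.set_self a k) hN hk)
  | ite_true c s₁ s₂ q pc => exact .ite_true c s₁ s₂ q pc₁
  | ite_false c s₁ s₂ q pc => exact .ite_false c s₁ s₂ q pc₁
  | _ => exact .while _ _ _ pc₁

theorem Step.finite (h : Step N s q pc s' q' pc') : pc'.Finite := by
  rcases h.cases_active with ⟨-, rfl⟩ | ⟨c, -, -, rfl, -⟩ | ⟨a, b, k, -, -, -, -, rfl⟩ |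
    ⟨a, n, f, bs, k, -, -, -, -, rfl⟩
  · exact Set.finite_empty
  all_goals exact Set.finite_singleton _

theorem Step.satisfiable (h : Step N s q pc s' q' pc') (hs : Satisfiable pc) :
    Satisfiable (pc ∪ pc') := by
  rcases h.cases_active with ⟨-, rfl⟩ | ⟨c, -, -, rfl, hc⟩ | ⟨a, b, k, -, -, hk, -, rfl⟩ |
    ⟨a, n, f, bs, k, -, -, hk, -, rfl⟩
  · rwa [Set.union_empty]
  · exact hc
  · refine hs.union_def hk.1 fun h => hk.2 ⟨b, ?_⟩
    simpa using (subterm_var.1 h).symm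
  · refine hs.union_def hk.1 fun h => ?_
    obtain ⟨i, hi⟩ := subterm_cst_func.1 h
    exact hk.2 ⟨bs i, by simpa using (subterm_var.1 hi).symm⟩

theorem Step.fresh_of_range (h : Step N s q pc s' q' pc') (a : Var) :
    q' a ∈ Set.range q ∨ Sum.inl (q' a) ∉ consts pc := by
  have key : ∀ b k, Fresh q pc k → q' = q.set b k →
      q' a ∈ Set.range q ∨ Sum.inl (q' a) ∉ consts pc := by
    rintro b k hk rfl
    rcases q.range_set_subset b k ⟨a, rfl⟩ with h | h
    · rw [h]
      exact .inr hk.1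
    · exact .inl h
  rcases h.cases_active with ⟨rfl, -⟩ | ⟨c, -, rfl, -, -⟩ | ⟨b, -, k, -, -, hk, hq, -⟩ |
    ⟨b, n, f, bs, k, -, -, hk, hq, -⟩
  · exact .inl ⟨a, rfl⟩
  · exact .inl ⟨a, rfl⟩
  · exact key b k hk hq
  · exact key b k hk hq

/-! ### Reachable configurations and their abstractions -/

variable {q₀ : State Var K} {P : Stmt L Var}

theorem reach_finite_satisfiable {c : Config L Var K} (h : (programTS q₀ N P).Reach c) :
    c.pc.Finite ∧ Satisfiable c.pc := by
  induction h with
  | refl => exact ⟨Set.finite_empty, satisfiable_iff.2 fun _ _ h => h.elim⟩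
  | tail _ hstep ih =>
    obtain ⟨pc', hstep, hpc⟩ := hstep
    rw [hpc]
    exact ⟨ih.1.union hstep.finite, hstep.satisfiable ih.2⟩

theorem Coherent.memo_deq (hP : Coherent q₀ N P) (hr : (programTS q₀ N P).Reach ⟨s, q, pc⟩)
    {a : Var} {n : ℕ} {f : L.Functions n} {bs : Fin n → Var} (hs : s.active = .assignFn a f bs) :
    ∀ t ∈ terms pc, DEq pc t (appc f fun i => Sum.inl (q (bs i))) →
      ∃ e ∈ Set.range q, DEq pc (cst (Sum.inl e)) t := by
  intro t ht htf
  obtain ⟨z, hz⟩ := hP.memoizing s q pc hr a n f bs hs t ht htf.entails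
  exact ⟨q z, ⟨z, rfl⟩, hz.deq (reach_finite_satisfiable hr).2⟩

theorem Coherent.early_deq (hP : Coherent q₀ N P) (hr : (programTS q₀ N P).Reach ⟨s, q, pc⟩)
    {c : Cond Var} (hs : s.active = .assume c) :
    ∀ a b, c = .eq a b → ∀ t ∈ terms pc, ∀ r, (Subterm (q.val a) r ∨ Subterm (q.val b) r) →
      DEq pc t r → ∃ e ∈ Set.range q, DEq pc (cst (Sum.inl e)) t := by
  rintro a b rfl t ht r hr' htr
  obtain ⟨z, hz⟩ := hP.earlyAssume s q pc hr a b hs t ht r hr' htr.entails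
  exact ⟨q z, ⟨z, rfl⟩, hz.deq (reach_finite_satisfiable hr).2⟩

section

variable [Finite Var] {α : Set K → Lits L K → Lits L K}

theorem IsBaseAbstraction.isBase_of_reach (hα : IsBaseAbstraction α)
    (hr : (programTS q₀ N P).Reach ⟨s, q, pc⟩) : IsBase pc (Set.range q) (α (Set.range q) pc) :=
  hα.isBase _ (Set.finite_range q) _ (reach_finite_satisfiable hr).1
    (reach_finite_satisfiable hr).2

/-- A reachable configuration and its abstraction have the same steps. -/
theorem Coherent.step_iff (hP : Coherent q₀ N P) (hα : IsBaseAbstraction α)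
    (hr : (programTS q₀ N P).Reach ⟨s, q, pc⟩)
    (hq' : ∀ a, ((∃ b, s.active = .assign a b) ∨
      ∃ (n : ℕ) (f : L.Functions n) (bs : Fin n → Var), s.active = .assignFn a f bs) →
      N q a (q' a) → q' a ∈ Set.range q ∨ Sum.inl (q' a) ∉ consts pc) :
    Step N s q pc s' q' pc' ↔ Step N s q (α (Set.range q) pc) s' q' pc' := by
  have hb := hα.isBase_of_reach hr
  have hsat := fun c (hs : s.active = .assume c) =>
    hb.satisfiable_union_cond_iff (reach_finite_satisfiable hr).2 (fun a => ⟨a, rfl⟩)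
      (hP.early_deq hr hs)
  constructor
  · intro h
    exact h.transfer (fun c hs => (hsat c hs).1)
      -- All program constants of a base lie in the range of `q`, so a fresh name stays fresh after
      -- abstraction. The converse needs `hq'`, since abstraction forgets constants of `pc`.
      fun a k _ _ _ hk => ⟨fun hk' => hk.2 (mem_of_inl_mem_consts hb.shape hk'), hk.2⟩
  · intro h
    refine h.transfer (fun c hs => (hsat c hs).2) ?_
    rintro a _ ha rfl hN hk
    exact ⟨(hq' a ha hN).resolve_left hk.2, hk.2⟩

variable [IsEmpty (L.Functions 0)]

theorem Coherent.interfaceEquiv_step (hP : Coherent q₀ N P) (hα : IsBaseAbstraction α)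
    (hr : (programTS q₀ N P).Reach ⟨s, q, pc⟩) (h : Step N s q pc s' q' pc') :
    InterfaceEquiv (Set.range q') (pc ∪ pc') (α (Set.range q) pc ∪ pc') := by
  have hb := hα.isBase_of_reach hr
  rcases h.cases_active with ⟨rfl, rfl⟩ | ⟨c, hs, rfl, rfl, hc⟩ |
    ⟨a, b, k, -, -, hk, rfl, rfl⟩ | ⟨a, n, f, bs, k, hs, -, hk, rfl, rfl⟩
  · simpa only [Set.union_empty] using hb.interfaceEquiv
  · exact hb.interfaceEquiv_union_cond (reach_finite_satisfiable hr).2 (fun a => ⟨a, rfl⟩)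
      (hP.early_deq hr hs) hc
  · exact (hb.interfaceEquiv.union_copy ⟨b, rfl⟩ hk.2 hk.1
      fun hk' => hk.2 (mem_of_inl_mem_consts hb.shape hk')).anti (q.range_set_subset a k)
  · exact (hb.interfaceEquiv.union_fn hb.shape (fun i => ⟨bs i, rfl⟩) hk.2 hk.1
      (hP.memo_deq hr hs)).anti (q.range_set_subset a k)

/-- The abstraction of a successor is determined by the abstraction. -/
theorem Coherent.abs_step (hP : Coherent q₀ N P) (hα : IsBaseAbstraction α)
    (hr : (programTS q₀ N P).Reach ⟨s, q, pc⟩) (h : Step N s q pc s' q' pc') :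
    α (Set.range q') (pc ∪ pc') = α (Set.range q') (α (Set.range q) pc ∪ pc') := by
  have hb := hα.isBase_of_reach hr
  obtain ⟨hfin, hsat⟩ := reach_finite_satisfiable hr
  have h' := (hP.step_iff hα hr fun a _ _ => h.fresh_of_range a).1 h
  exact hα.eq_of_interfaceEquiv (Set.finite_range q') (hfin.union h.finite) (h.satisfiable hsat)
    (hb.finite.union h.finite) (h'.satisfiable (hb.satisfiable hsat))
    (hP.interfaceEquiv_step hα hr h)

/-- An abstract transition comes from some reachable configuration with the same abstraction, and
`Coherent.step_iff` moves the step through that abstraction. -/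
theorem Coherent.isBisimulation (hP : Coherent q₀ N P) (hα : IsBaseAbstraction α)
    (hN : AlwaysFresh q₀ N P) :
    IsBisimulation (programTS q₀ N P) ((programTS q₀ N P).reachablePart.abs (absConfig α))
      (fun c d => (programTS q₀ N P).Reach c ∧ d = absConfig α c) := by
  constructor
  · rintro c _ ⟨hr, rfl⟩ c' htr
    exact ⟨_, ⟨c, c', ⟨hr, htr⟩, rfl, rfl⟩, hr.tail htr, rfl⟩
  · rintro _ ⟨s, q, pc⟩ ⟨hr, rfl⟩ _ ⟨⟨s₁, q₁, pc₁⟩, ⟨s', q', _⟩, ⟨hr₁, pc', hstep, rfl⟩, heq, rfl⟩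
    simp only [absConfig, Config.mk.injEq] at heq
    obtain ⟨rfl, rfl, hα'⟩ := heq
    have hstep' := (hP.step_iff hα hr₁ fun a _ _ => hstep.fresh_of_range a).1 hstep
    rw [← hα'] at hstep'
    -- The name created may have been fresh only for the other configuration; `hN` makes it fresh
    -- here.
    have hstep'' := (hP.step_iff hα hr fun a ha hNa => .inr (hN s q pc hr a ha _ hNa).1).2 hstep'
    have htr : (programTS q₀ N P).tr ⟨s, q, pc⟩ ⟨s', q', pc ∪ pc'⟩ := ⟨pc', hstep'', rfl⟩
    refine ⟨⟨s', q', pc ∪ pc'⟩, htr, hr.tail htr, ?_⟩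
    simp only [absConfig, Config.mk.injEq, true_and]
    rw [hP.abs_step hα hr hstep'', hP.abs_step hα hr₁ hstep, hα']

end

end UP

theorem mainTheorem2 {L : FirstOrder.Language.{u, v}} [IsEmpty (L.Functions 0)]
    {Var : Type x} [Finite Var] {K : Type w}
    (q₀ : Var → K) (hq₀ : Function.Injective q₀) (N : UP.Naming Var K)
    (P : UP.Stmt L Var) (hP : UP.Coherent q₀ N P) :
    (∃ α : Set K → UP.Lits L K → UP.Lits L K, UP.IsBaseAbstraction α) ∧
    ∀ α : Set K → UP.Lits L K → UP.Lits L K, UP.IsBaseAbstraction α →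
      -- (1)
      (∀ s q pc, (UP.programTS q₀ N P).Reach ⟨s, q, pc⟩ → ∀ s' q' pc',
        (∀ a, q' a ∈ Set.range q ∨ Sum.inl (q' a) ∉ UP.consts pc) →
        (UP.Step N s q pc s' q' pc' ↔
          UP.Step N s q (α (Set.range q) pc) s' q' pc')) ∧
      -- (2)
      (∀ s q pc, (UP.programTS q₀ N P).Reach ⟨s, q, pc⟩ → ∀ s' q' pc',
        UP.Step N s q pc s' q' pc' →
        α (Set.range q') (pc ∪ pc') = α (Set.range q') (α (Set.range q) pc ∪ pc')) ∧
      -- the corollary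
      (UP.AlwaysFresh q₀ N P →
        UP.IsBisimulation (UP.programTS q₀ N P)
          ((UP.programTS q₀ N P).reachablePart.abs (UP.absConfig α))
          (fun c d => (UP.programTS q₀ N P).Reach c ∧ d = UP.absConfig α c)) :=
  ⟨UP.exists_isBaseAbstraction, fun _ hα =>
    ⟨fun _ _ _ hr _ _ _ hq' => hP.step_iff hα hr fun a _ _ => hq' a,
      fun _ _ _ hr _ _ _ h => hP.abs_step hα hr h, hP.isBisimulation hα⟩⟩
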